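/- For $k\in\mathbb{Z}$ let $\widetilde I_k=\{\xi\in\mathbb{R}: 2^{k-1}\le|\xi|\le 2^{k+1}\}$, and for $\xi\ne 0$, $\mu\in\mathbb{R}$ let $$\omega(\xi,\mu)=\xi^3+\mu^2/\xi,\qquad p(\xi,\mu)=1+\frac{|\mu|}{|\xi|+|\xi|^2}.$$ For $k\in\mathbb{Z}$ and $l,j\in\mathbb{R}$ let $D_{k,l,j}=\{(\xi,\mu,\tau)\in\mathbb{R}^3:\ \xi\in\widetilde I_k,\ |\mu|\le 2^l,\ |\tau-\omega(\xi,\mu)|\le 2^j\}$, and let $D_{k,\infty,j}=\bigcup_{l\in\mathbb{Z}}D_{k,l,j}$. There is an absolute constant $C>0$ such that the following holds for all $k_1,k_2,k\in\mathbb{Z}$, all integers $j_1,j_2,j\ge 0$, and all nonnegative functions $f_1,f_2\in L^2(\mathbb{R}^3)$ such that $f_i$ is supported in $D_{k_i,\infty,j_i}$ for $i=1,2$. (a) $$\|\mathbf 1_{D_{k,\infty,j}}\cdot(f_1\ast f_2)\|_{L^2}\le C\,2^{(j_1+j_2+j)/2}\,\big(2^{\max(j_1,j_2,j)}+2^{k_1+k_2+k}\big)^{-1/2}\,\|f_1\|_{L^2}\|f_2\|_{L^2}.$$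 (b) If $k_1\le 100$, then $$\|\mathbf 1_{D_{k,\infty,j}}\cdot(f_1\ast f_2)\|_{L^2}\le C\,2^{[k_1+\min(k_1,k_2,k)+\min(j_1,j_2,j)]/2}\,\|p(\xi_1,\mu_1)\, f_1\|_{L^2}\|f_2\|_{L^2},$$ and if $k_1\ge -100$, then $$\|\mathbf 1_{D_{k,\infty,j}}\cdot(f_1\ast f_2)\|_{L^2}\le C\,2^{[2k_1+\min(k_1,k_2,k)+\min(j_1,j_2,j)]/2}\,\|p(\xi_1,\mu_1)\, f_1\|_{L^2}\|f_2\|_{L^2}.$$ Here $p(\xi_1,\mu_1)f_1$ denotes the function $(\xi_1,\mu_1,\tau_1)\mapsto p(\xi_1,\mu_1)f_1(\xi_1,\mu_1,\tau_1)$, whose $L^2$ norm may be $+\infty$ (with $\infty\cdot 0=0$). -/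

import Mathlib

open MeasureTheory
open scoped Convolution ENNReal

noncomputable section

/-- The set of `ξ` with `|ξ| ∈ [2^(k-1), 2^(k+1)]`. -/
def dyadicShell (k : ℤ) : Set ℝ :=
  {ξ | (2 : ℝ) ^ (k - 1) ≤ |ξ| ∧ |ξ| ≤ (2 : ℝ) ^ (k + 1)}

/-- The dispersion relation `ω(ξ, μ) = ξ³ + μ²/ξ`; it is only used at `ξ ≠ 0`. -/
def kpOmega (ξ μ : ℝ) : ℝ := ξ ^ 3 + μ ^ 2 / ξ

/-- The weight `p(ξ, μ) = 1 + |μ| / (|ξ| + |ξ|²)`; it is only used at `ξ ≠ 0`. -/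
def kpWeight (ξ μ : ℝ) : ℝ := 1 + |μ| / (|ξ| + |ξ| ^ 2)

/-- `D_{k,l,j}`, a set of triples `(ξ, μ, τ)`. -/
def kpRegion (k : ℤ) (l j : ℝ) : Set (ℝ × ℝ × ℝ) :=
  {x | x.1 ∈ dyadicShell k ∧ |x.2.1| ≤ (2 : ℝ) ^ l ∧
    |x.2.2 - kpOmega x.1 x.2.1| ≤ (2 : ℝ) ^ j}

/-- `D_{k,∞,j}`, the union of the sets `D_{k,l,j}` over all integers `l`. -/
def kpRegionTop (k : ℤ) (j : ℝ) : Set (ℝ × ℝ × ℝ) :=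
  ⋃ l : ℤ, kpRegion k (l : ℝ) j

/-- `f` is a nonnegative square-integrable function on `ℝ³` that vanishes (almost everywhere)
outside `D`. -/
def IsNonnegL2SupportedIn (f : ℝ × ℝ × ℝ → ℝ) (D : Set (ℝ × ℝ × ℝ)) : Prop :=
  MemLp f 2 volume ∧ (∀ᵐ x, 0 ≤ f x) ∧ ∀ᵐ x, x ∉ D → f x = 0

/-- The `L²(ℝ³)` norm of `1_D · (f₁ ∗ f₂)`. -/
def restrictedConvNorm (D : Set (ℝ × ℝ × ℝ)) (f₁ f₂ : ℝ × ℝ × ℝ → ℝ) : ℝ≥0∞ :=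
  eLpNorm (D.indicator (f₁ ⋆[ContinuousLinearMap.mul ℝ ℝ, volume] f₂)) 2 volume

end

/-!
By duality each bound is an estimate for the form `∫∫ F₁(a) F₂(b) F₃(-(a + b)) da db`, which is
symmetric in its three arguments because the regions `D_{k,∞,j}` are symmetric under reflection.

For the weighted bounds, Cauchy–Schwarz in `τ` costs the smallest modulation, Young's inequality in
`μ` costs `∫ p(ξ, μ)⁻² dμ ≲ |ξ| + |ξ|²`, and Cauchy–Schwarz in `ξ` costs the smallest frequency.

For the unweighted bound, let `j₃` be the largest modulation exponent. If `2 ^ (k₁ + k₂ + k₃)` is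
at most a multiple of `2 ^ j₃`, one needs `‖F₁ ∗ F₂‖₂² ≲ 2 ^ (j₁ + j₂) ‖F₁‖₂² ‖F₂‖₂²`. Since
`‖u₁ u₂‖₂ = ‖u₁ ū₂‖₂`, all frequencies may be taken positive, and then the bound is that of the
area of a sublevel set of `ω(ξ₁, μ₁) + ω(ξ - ξ₁, μ - μ₁)`, a quadratic polynomial in `μ₁`.

Otherwise the interaction is resonant. The resonance function factors as
`ξ₁ ξ₂ / (ξ₁ + ξ₂) * (β₂ - β₁) * (β₂' - β₁')`, where `β₁, β₂'` are the numbers `μ / ξ - √3 ξ` of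
the two points and `β₁', β₂` are their numbers `μ / ξ + √3 ξ`. As the two differences are at least
`2 |ξ₁ + ξ₂|` apart, one of them is at most `R ~ 2 ^ (j₃ - k₁ - k₂)`. Along the curves on which the
modulation and the slope `β` of each point are constant, Cauchy–Schwarz reduces the bound to a
change of variables, whose Jacobian is computed from the factored resonance function.
-/

theorem rpow_two_inv_sq (x : ℝ≥0∞) : (x ^ (2⁻¹ : ℝ)) ^ 2 = x :=
  ENNReal.rpow_inv_natCast_pow two_ne_zero x

theorem le_rpow_two_inv_iff {x y : ℝ≥0∞} : x ≤ y ^ (2⁻¹ : ℝ) ↔ x ^ 2 ≤ y := by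
  rw [ENNReal.le_rpow_inv_iff two_pos, ENNReal.rpow_ofNat]

theorem ennreal_add_sq_le (x y : ℝ≥0∞) : (x + y) ^ 2 ≤ 2 * (x ^ 2 + y ^ 2) := by
  have h := ENNReal.rpow_add_le_mul_rpow_add_rpow x y one_le_two
  norm_num at h
  exact h

section CauchySchwarz

variable {α : Type*} [MeasurableSpace α] {μ : Measure α} {f g : α → ℝ≥0∞}

theorem sq_lintegral_mul_le (hf : AEMeasurable f μ) (hg : AEMeasurable g μ) :
    (∫⁻ x, f x * g x ∂μ) ^ 2 ≤ (∫⁻ x, f x ^ 2 ∂μ) * ∫⁻ x, g x ^ 2 ∂μ := by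
  have holder := ENNReal.lintegral_mul_le_Lp_mul_Lq μ Real.HolderConjugate.two_two hf hg
  simp only [ENNReal.rpow_ofNat, Pi.mul_apply, one_div] at holder
  calc (∫⁻ x, f x * g x ∂μ) ^ 2
      ≤ ((∫⁻ x, f x ^ 2 ∂μ) ^ (2⁻¹ : ℝ) * (∫⁻ x, g x ^ 2 ∂μ) ^ (2⁻¹ : ℝ)) ^ 2 := by gcongr
    _ = _ := by rw [mul_pow, rpow_two_inv_sq, rpow_two_inv_sq]

theorem sq_lintegral_le_of_support_subset (hf : AEMeasurable f μ) {S : Set α}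
    (hfS : f.support ⊆ S) : (∫⁻ x, f x ∂μ) ^ 2 ≤ μ S * ∫⁻ x, f x ^ 2 ∂μ := by
  have hS := sq_lintegral_mul_le (f := 1) aemeasurable_const (hf.restrict (s := S))
  simp only [Pi.one_apply, one_mul, one_pow, setLIntegral_one] at hS
  rw [setLIntegral_eq_of_support_subset hfS] at hS
  exact hS.trans (mul_le_mul_right (setLIntegral_le_lintegral _ _) _)

theorem sq_lintegral_mul_le_of_forall_sq_le (hf : AEMeasurable f μ) {K : ℝ≥0∞}
    (hg : ∀ x, g x ^ 2 ≤ K) : (∫⁻ x, f x * g x ∂μ) ^ 2 ≤ (∫⁻ x, f x ∂μ) ^ 2 * K := by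
  calc (∫⁻ x, f x * g x ∂μ) ^ 2 ≤ (∫⁻ x, f x * K ^ (2⁻¹ : ℝ) ∂μ) ^ 2 := by
        gcongr with x
        exact le_rpow_two_inv_iff.2 (hg x)
    _ = (∫⁻ x, f x ∂μ) ^ 2 * K := by
        rw [lintegral_mul_const'' _ hf, mul_pow, rpow_two_inv_sq]

theorem sq_lintegral_le_of_forall_sq_le_mul {F : α → ℝ≥0∞} (hf : AEMeasurable f μ)
    (hg : AEMeasurable g μ) (h : ∀ x, F x ^ 2 ≤ f x * g x) :
    (∫⁻ x, F x ∂μ) ^ 2 ≤ (∫⁻ x, f x ∂μ) * ∫⁻ x, g x ∂μ := by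
  calc (∫⁻ x, F x ∂μ) ^ 2
      ≤ (∫⁻ x, f x ^ (2⁻¹ : ℝ) * g x ^ (2⁻¹ : ℝ) ∂μ) ^ 2 := by
        gcongr with x
        rw [← ENNReal.mul_rpow_of_nonneg _ _ (by norm_num : (0 : ℝ) ≤ 2⁻¹)]
        exact le_rpow_two_inv_iff.2 (h x)
    _ ≤ (∫⁻ x, f x ∂μ) * ∫⁻ x, g x ∂μ := by
        refine (sq_lintegral_mul_le (hf.pow_const _) (hg.pow_const _)).trans_eq ?_
        simp only [rpow_two_inv_sq]

end CauchySchwarz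

/-! ### The dual trilinear form -/

/-- The form `∫∫ F₁(a) F₂(b) F₃(-(a + b)) da db` dual to convolution; putting `-(a + b)` rather
than `a + b` in the third slot makes it symmetric in its three arguments. -/
noncomputable def trilinearForm {α : Type*} [MeasureSpace α] [AddCommGroup α]
    (F₁ F₂ F₃ : α → ℝ≥0∞) : ℝ≥0∞ :=
  ∫⁻ a, ∫⁻ b, F₁ a * F₂ b * F₃ (-(a + b))

section Trilinear

variable {α : Type*} [MeasureSpace α] [AddCommGroup α] [MeasurableAdd₂ α] [MeasurableNeg α]
  {F₁ F₂ F₃ : α → ℝ≥0∞}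

section Invariant

variable [(volume : Measure α).IsAddLeftInvariant] [(volume : Measure α).IsNegInvariant]

theorem trilinearForm_swap_right (F₁ F₂ F₃ : α → ℝ≥0∞) :
    trilinearForm F₁ F₂ F₃ = trilinearForm F₁ F₃ F₂ := by
  unfold trilinearForm
  refine lintegral_congr fun a => ?_
  rw [← lintegral_sub_left_eq_self (fun b => F₁ a * F₃ b * F₂ (-(a + b))) (-a)]
  refine lintegral_congr fun b => ?_
  rw [show -(a + (-a - b)) = b by abel, show -a - b = -(a + b) by abel]
  ring

/-- Young's inequality `L¹ ∗ L² ⊆ L²`, tested against `F₃`. -/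
theorem sq_trilinearForm_le_lintegral (h₁ : Measurable F₁) (h₂ : Measurable F₂)
    (h₃ : Measurable F₃) :
    trilinearForm F₁ F₂ F₃ ^ 2 ≤ (∫⁻ x, F₁ x) ^ 2 * ((∫⁻ x, F₂ x ^ 2) * ∫⁻ x, F₃ x ^ 2) := by
  have hinner (a : α) :
      (∫⁻ b, F₂ b * F₃ (-(a + b))) ^ 2 ≤ (∫⁻ x, F₂ x ^ 2) * ∫⁻ x, F₃ x ^ 2 := by
    refine (sq_lintegral_mul_le (by fun_prop) (by fun_prop)).trans_eq ?_
    rw [← lintegral_sub_left_eq_self (fun x => F₃ x ^ 2) (-a)]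
    simp only [neg_add']
  have hform : trilinearForm F₁ F₂ F₃ = ∫⁻ a, F₁ a * ∫⁻ b, F₂ b * F₃ (-(a + b)) := by
    refine lintegral_congr fun a => ?_
    simp only [mul_assoc]
    exact lintegral_const_mul _ (by fun_prop)
  rw [hform]
  exact sq_lintegral_mul_le_of_forall_sq_le h₁.aemeasurable hinner

theorem sq_trilinearForm_le_of_support_subset (h₁ : Measurable F₁) (h₂ : Measurable F₂)
    (h₃ : Measurable F₃) {S : Set α} (hS : F₁.support ⊆ S) :
    trilinearForm F₁ F₂ F₃ ^ 2 ≤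
      volume S * (∫⁻ x, F₁ x ^ 2) * (∫⁻ x, F₂ x ^ 2) * ∫⁻ x, F₃ x ^ 2 := by
  refine (sq_trilinearForm_le_lintegral h₁ h₂ h₃).trans ?_
  rw [mul_assoc (volume S * _)]
  gcongr
  exact sq_lintegral_le_of_support_subset h₁.aemeasurable hS

end Invariant

variable [SFinite (volume : Measure α)]

theorem trilinearForm_swap_left (h₁ : Measurable F₁) (h₂ : Measurable F₂) (h₃ : Measurable F₃) :
    trilinearForm F₁ F₂ F₃ = trilinearForm F₂ F₁ F₃ := by
  unfold trilinearForm
  rw [lintegral_lintegral_swap (by fun_prop)]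
  simp only [mul_comm (F₁ _), add_comm]

variable [(volume : Measure α).IsAddLeftInvariant]

theorem trilinearForm_eq_lintegral_lconvolution (h₁ : Measurable F₁) (h₂ : Measurable F₂)
    (h₃ : Measurable F₃) :
    trilinearForm F₁ F₂ F₃ = ∫⁻ x, (F₁ ⋆ₗ F₂) x * F₃ (-x) :=
  calc trilinearForm F₁ F₂ F₃ = ∫⁻ a, ∫⁻ x, F₁ a * F₂ (-a + x) * F₃ (-x) := by
        refine lintegral_congr fun a => ?_
        rw [← lintegral_add_left_eq_self (fun x => F₁ a * F₂ (-a + x) * F₃ (-x)) a]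
        simp only [neg_add_cancel_left]
    _ = ∫⁻ x, ∫⁻ a, F₁ a * F₂ (-a + x) * F₃ (-x) := lintegral_lintegral_swap (by fun_prop)
    _ = _ := lintegral_congr fun x => lintegral_mul_const _ (by fun_prop)

theorem lintegral_sq_lconvolution (h₁ : Measurable F₁) (h₂ : Measurable F₂) :
    ∫⁻ x, (F₁ ⋆ₗ F₂) x ^ 2 = ∫⁻ s, ∫⁻ t, ∫⁻ b, F₁ s * F₁ t * F₂ b * F₂ (t - s + b) :=
  calc ∫⁻ x, (F₁ ⋆ₗ F₂) x ^ 2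
      = ∫⁻ x, ∫⁻ s, ∫⁻ t, F₁ s * F₂ (-s + x) * (F₁ t * F₂ (-t + x)) := by
        refine lintegral_congr fun x => ?_
        rw [sq, lconvolution_def, ← lintegral_mul_const _ (by fun_prop)]
        exact lintegral_congr fun s => (lintegral_const_mul _ (by fun_prop)).symm
    _ = ∫⁻ s, ∫⁻ x, ∫⁻ t, F₁ s * F₂ (-s + x) * (F₁ t * F₂ (-t + x)) :=
        lintegral_lintegral_swap (by fun_prop)
    _ = ∫⁻ s, ∫⁻ t, ∫⁻ x, F₁ s * F₂ (-s + x) * (F₁ t * F₂ (-t + x)) :=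
        lintegral_congr fun s => lintegral_lintegral_swap (by fun_prop)
    _ = _ := by
        refine lintegral_congr fun s => lintegral_congr fun t => ?_
        rw [← lintegral_add_left_eq_self _ t]
        refine lintegral_congr fun b => ?_
        rw [neg_add_cancel_left, ← add_assoc, neg_add_eq_sub]
        ring

theorem lintegral_sq_lconvolution_le_of_fiber (h₁ : Measurable F₁) (h₂ : Measurable F₂)
    {M : ℝ≥0∞} {E : α → Set α} (hE : ∀ x, (fun t => F₁ t * F₂ (-t + x)).support ⊆ E x)
    (hM : ∀ x, volume (E x) ≤ M) :
    ∫⁻ x, (F₁ ⋆ₗ F₂) x ^ 2 ≤ M * (∫⁻ x, F₁ x ^ 2) * ∫⁻ x, F₂ x ^ 2 :=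
  calc ∫⁻ x, (F₁ ⋆ₗ F₂) x ^ 2 ≤ ∫⁻ x, M * ∫⁻ t, F₁ t ^ 2 * F₂ (-t + x) ^ 2 := by
        gcongr with x
        refine (sq_lintegral_le_of_support_subset (by fun_prop) (hE x)).trans ?_
        simp only [mul_pow]
        gcongr
        exact hM x
    _ = M * ∫⁻ t, ∫⁻ x, F₁ t ^ 2 * F₂ (-t + x) ^ 2 := by
        rw [lintegral_const_mul _ (by fun_prop), lintegral_lintegral_swap (by fun_prop)]
    _ = M * ∫⁻ t, F₁ t ^ 2 * ∫⁻ x, F₂ x ^ 2 := by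
        congr 1
        refine lintegral_congr fun t => ?_
        rw [lintegral_const_mul _ (by fun_prop),
          lintegral_add_left_eq_self (fun x => F₂ x ^ 2)]
    _ = _ := by rw [lintegral_mul_const _ (by fun_prop), mul_assoc]

variable [(volume : Measure α).IsNegInvariant]

theorem sq_trilinearForm_le_lconvolution (h₁ : Measurable F₁) (h₂ : Measurable F₂)
    (h₃ : Measurable F₃) :
    trilinearForm F₁ F₂ F₃ ^ 2 ≤ (∫⁻ x, (F₁ ⋆ₗ F₂) x ^ 2) * ∫⁻ x, F₃ x ^ 2 := by
  rw [trilinearForm_eq_lintegral_lconvolution h₁ h₂ h₃,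
    ← lintegral_neg_eq_self (fun x => F₃ x ^ 2)]
  exact sq_lintegral_mul_le (by fun_prop) (by fun_prop)

/-- This is `‖u₁ u₂‖₂ = ‖u₁ ū₂‖₂` on the Fourier side. -/
theorem lintegral_sq_lconvolution_comp_neg (h₁ : Measurable F₁) (h₂ : Measurable F₂) :
    ∫⁻ x, (F₁ ⋆ₗ fun y => F₂ (-y)) x ^ 2 = ∫⁻ x, (F₁ ⋆ₗ F₂) x ^ 2 := by
  rw [lintegral_sq_lconvolution h₁ h₂, lintegral_sq_lconvolution h₁ (by fun_prop),
    lintegral_lintegral_swap (by fun_prop)]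
  refine lintegral_congr fun s => lintegral_congr fun t => ?_
  rw [← lintegral_neg_eq_self]
  refine lintegral_congr fun b => ?_
  rw [neg_neg, show -(s - t + -b) = t - s + b by abel, mul_comm (F₁ t)]

theorem lintegral_sq_indicator_lconvolution_le_of_dual (h₁ : Measurable F₁) (h₂ : Measurable F₂)
    {K : ℝ≥0∞} {D : Set α} (hD : MeasurableSet D) (hDneg : -D = D)
    (hfin : ∫⁻ x, (F₁ ⋆ₗ F₂) x ^ 2 ≠ ∞)
    (hK : ∀ F₃ : α → ℝ≥0∞, Measurable F₃ → F₃.support ⊆ D →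
      trilinearForm F₁ F₂ F₃ ^ 2 ≤ K * ∫⁻ x, F₃ x ^ 2) :
    ∫⁻ x, D.indicator (F₁ ⋆ₗ F₂) x ^ 2 ≤ K := by
  set G : α → ℝ≥0∞ := D.indicator (F₁ ⋆ₗ F₂) with hG
  have hGm : Measurable G := (measurable_lconvolution _ h₁ h₂).indicator hD
  have hGsupp : (fun x => G (-x)).support ⊆ D := fun x hx => by
    rw [← hDneg]
    exact Set.support_indicator_subset hx
  have hform : trilinearForm F₁ F₂ (fun x => G (-x)) = ∫⁻ x, G x ^ 2 := by
    rw [trilinearForm_eq_lintegral_lconvolution h₁ h₂ (by fun_prop)]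
    refine lintegral_congr fun x => ?_
    by_cases hx : x ∈ D <;> simp [hG, hx, sq]
  have hGfin : ∫⁻ x, G x ^ 2 ≠ ∞ := ne_top_of_le_ne_top hfin <| by
    gcongr with x
    exact Set.indicator_le_self _ _ x
  have key := hK _ (by fun_prop) hGsupp
  rw [hform, lintegral_neg_eq_self (fun x => G x ^ 2), sq] at key
  rcases eq_or_ne (∫⁻ x, G x ^ 2) 0 with h0 | h0
  · exact h0 ▸ zero_le
  · exact (ENNReal.mul_le_mul_iff_left h0 hGfin).1 key

theorem sq_trilinearForm_le_min_support (h₁ : Measurable F₁) (h₂ : Measurable F₂)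
    (h₃ : Measurable F₃) {S₁ S₂ S₃ : Set α} (hS₁ : F₁.support ⊆ S₁) (hS₂ : F₂.support ⊆ S₂)
    (hS₃ : F₃.support ⊆ S₃) :
    trilinearForm F₁ F₂ F₃ ^ 2 ≤ min (volume S₁) (min (volume S₂) (volume S₃)) *
      (∫⁻ x, F₁ x ^ 2) * (∫⁻ x, F₂ x ^ 2) * ∫⁻ x, F₃ x ^ 2 := by
  rcases min_choice (volume S₁) (min (volume S₂) (volume S₃)) with h | h <;> rw [h]
  · exact sq_trilinearForm_le_of_support_subset h₁ h₂ h₃ hS₁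
  rcases min_choice (volume S₂) (volume S₃) with h | h <;> rw [h]
  · rw [trilinearForm_swap_left h₁ h₂ h₃]
    exact (sq_trilinearForm_le_of_support_subset h₂ h₁ h₃ hS₂).trans_eq (by ring)
  · rw [trilinearForm_swap_right, trilinearForm_swap_left h₁ h₃ h₂]
    exact (sq_trilinearForm_le_of_support_subset h₃ h₁ h₂ hS₃).trans_eq (by ring)

end Trilinear

section Product

variable {α β : Type*} [MeasureSpace β]

/-- The function `a ↦ ‖F(a, ·)‖₂` on the first factor of a product. -/
noncomputable def sliceL2Norm (F : α × β → ℝ≥0∞) (a : α) : ℝ≥0∞ :=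
  (∫⁻ b, F (a, b) ^ 2) ^ (2⁻¹ : ℝ)

theorem sq_sliceL2Norm (F : α × β → ℝ≥0∞) (a : α) :
    sliceL2Norm F a ^ 2 = ∫⁻ b, F (a, b) ^ 2 :=
  rpow_two_inv_sq _

theorem support_sliceL2Norm_subset {F : α × β → ℝ≥0∞} {S : Set α}
    (hF : F.support ⊆ Prod.fst ⁻¹' S) : (sliceL2Norm F).support ⊆ S := fun a ha => by
  by_contra haS
  have hFa (b : β) : F (a, b) = 0 := Function.notMem_support.1 fun h => haS (hF h)
  simp [sliceL2Norm, hFa] at ha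

variable [MeasureSpace α] [SFinite (volume : Measure β)] {F F₁ F₂ F₃ : α × β → ℝ≥0∞}

theorem lintegral_sq_sliceL2Norm (hF : Measurable F) :
    ∫⁻ a, sliceL2Norm F a ^ 2 = ∫⁻ x, F x ^ 2 := by
  simp only [sq_sliceL2Norm]
  exact (lintegral_prod (fun x => F x ^ 2) (by fun_prop)).symm

@[fun_prop]
theorem measurable_sliceL2Norm (hF : Measurable F) : Measurable (sliceL2Norm F) := by
  unfold sliceL2Norm
  fun_prop

theorem sq_lintegral_sliceL2Norm_le (hF : Measurable F) {w : α → ℝ} (hw : Measurable w)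
    (hw0 : ∀ a, 0 < w a) :
    (∫⁻ a, sliceL2Norm F a) ^ 2 ≤
      (∫⁻ a, ENNReal.ofReal (w a)⁻¹ ^ 2) * ∫⁻ x, (ENNReal.ofReal (w x.1) * F x) ^ 2 := by
  have hweight : ∫⁻ x, (ENNReal.ofReal (w x.1) * F x) ^ 2 =
      ∫⁻ a, (ENNReal.ofReal (w a) * sliceL2Norm F a) ^ 2 := by
    refine (lintegral_prod _ (by fun_prop)).trans (lintegral_congr fun a => ?_)
    simp only [mul_pow, sq_sliceL2Norm]
    exact lintegral_const_mul _ (by fun_prop)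
  have hcancel (a : α) : sliceL2Norm F a =
      ENNReal.ofReal (w a)⁻¹ * (ENNReal.ofReal (w a) * sliceL2Norm F a) := by
    rw [← mul_assoc, ← ENNReal.ofReal_mul (inv_nonneg.2 (hw0 a).le),
      inv_mul_cancel₀ (hw0 a).ne', ENNReal.ofReal_one, one_mul]
  rw [hweight, lintegral_congr hcancel]
  exact sq_lintegral_mul_le (by fun_prop) (by fun_prop)

variable [SFinite (volume : Measure α)] [AddCommGroup α] [MeasurableAdd₂ α] [MeasurableNeg α]
  [AddCommGroup β] [MeasurableAdd₂ β] [MeasurableNeg β]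

theorem trilinearForm_prod (h₁ : Measurable F₁) (h₂ : Measurable F₂) (h₃ : Measurable F₃) :
    trilinearForm F₁ F₂ F₃ = ∫⁻ a, ∫⁻ a', trilinearForm (fun b => F₁ (a, b))
      (fun b => F₂ (a', b)) (fun b => F₃ (-(a + a'), b)) := by
  let H (x y : α × β) : ℝ≥0∞ := F₁ x * F₂ y * F₃ (-(x.1 + y.1), -(x.2 + y.2))
  calc ∫⁻ x, ∫⁻ y, H x y = ∫⁻ a, ∫⁻ b, ∫⁻ y, H (a, b) y := lintegral_prod _ (by fun_prop)
    _ = ∫⁻ a, ∫⁻ b, ∫⁻ a', ∫⁻ b', H (a, b) (a', b') :=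
        lintegral_congr fun a => lintegral_congr fun b => lintegral_prod _ (by fun_prop)
    _ = ∫⁻ a, ∫⁻ a', ∫⁻ b, ∫⁻ b', H (a, b) (a', b') :=
        lintegral_congr fun a => lintegral_lintegral_swap (by fun_prop)

theorem sq_trilinearForm_prod_le (h₁ : Measurable F₁) (h₂ : Measurable F₂) (h₃ : Measurable F₃)
    {G : α → ℝ≥0∞} (hG : Measurable G) {K : ℝ≥0∞}
    (hK : ∀ a a', trilinearForm (fun b => F₁ (a, b)) (fun b => F₂ (a', b))
        (fun b => F₃ (-(a + a'), b)) ^ 2 ≤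
      K * G a ^ 2 * (∫⁻ b, F₂ (a', b) ^ 2) * ∫⁻ b, F₃ (-(a + a'), b) ^ 2) :
    trilinearForm F₁ F₂ F₃ ^ 2 ≤
      K * trilinearForm G (sliceL2Norm F₂) (sliceL2Norm F₃) ^ 2 := by
  have hslice (a a' : α) : trilinearForm (fun b => F₁ (a, b)) (fun b => F₂ (a', b))
      (fun b => F₃ (-(a + a'), b)) ≤
      K ^ (2⁻¹ : ℝ) * (G a * sliceL2Norm F₂ a' * sliceL2Norm F₃ (-(a + a'))) := by
    rw [← ENNReal.pow_le_pow_left_iff two_ne_zero]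
    refine (hK a a').trans_eq ?_
    simp only [mul_pow, rpow_two_inv_sq, sq_sliceL2Norm, mul_assoc]
  have hform : trilinearForm F₁ F₂ F₃ ≤
      K ^ (2⁻¹ : ℝ) * trilinearForm G (sliceL2Norm F₂) (sliceL2Norm F₃) := by
    rw [trilinearForm_prod h₁ h₂ h₃, trilinearForm, ← lintegral_const_mul _ (by fun_prop)]
    gcongr with a
    rw [← lintegral_const_mul _ (by fun_prop)]
    gcongr with a'
    exact hslice a a'
  calc _ ≤ _ := pow_le_pow_left' hform 2
    _ = _ := by rw [mul_pow, rpow_two_inv_sq]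

theorem sq_trilinearForm_prod_le_lintegral [(volume : Measure α).IsAddLeftInvariant]
    [(volume : Measure α).IsNegInvariant] (h₁ : Measurable F₁) (h₂ : Measurable F₂)
    (h₃ : Measurable F₃) {K : ℝ≥0∞}
    (hK : ∀ a a', trilinearForm (fun b => F₁ (a, b)) (fun b => F₂ (a', b))
        (fun b => F₃ (-(a + a'), b)) ^ 2 ≤
      K * (∫⁻ b, F₁ (a, b) ^ 2) * (∫⁻ b, F₂ (a', b) ^ 2) * ∫⁻ b, F₃ (-(a + a'), b) ^ 2) :
    trilinearForm F₁ F₂ F₃ ^ 2 ≤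
      K * ((∫⁻ a, sliceL2Norm F₁ a) ^ 2 * ((∫⁻ x, F₂ x ^ 2) * ∫⁻ x, F₃ x ^ 2)) := by
  refine (sq_trilinearForm_prod_le h₁ h₂ h₃ (G := sliceL2Norm F₁) (by fun_prop)
    (by simpa only [sq_sliceL2Norm] using hK)).trans ?_
  rw [← lintegral_sq_sliceL2Norm h₂, ← lintegral_sq_sliceL2Norm h₃]
  gcongr
  exact sq_trilinearForm_le_lintegral (by fun_prop) (by fun_prop) (by fun_prop)

end Product

theorem sq_trilinearForm_le_of_support_closedBall {F₁ F₂ F₃ : ℝ → ℝ≥0∞} (h₁ : Measurable F₁)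
    (h₂ : Measurable F₂) (h₃ : Measurable F₃) {c₁ c₂ c₃ r₁ r₂ r₃ : ℝ}
    (s₁ : F₁.support ⊆ Metric.closedBall c₁ r₁) (s₂ : F₂.support ⊆ Metric.closedBall c₂ r₂)
    (s₃ : F₃.support ⊆ Metric.closedBall c₃ r₃) :
    trilinearForm F₁ F₂ F₃ ^ 2 ≤ ENNReal.ofReal (2 * min r₁ (min r₂ r₃)) *
      (∫⁻ x, F₁ x ^ 2) * (∫⁻ x, F₂ x ^ 2) * ∫⁻ x, F₃ x ^ 2 := by
  have hmono : Monotone fun r => ENNReal.ofReal (2 * r) := fun r s hrs => by dsimp only; gcongr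
  simpa only [Real.volume_closedBall, ← hmono.map_min] using
    sq_trilinearForm_le_min_support h₁ h₂ h₃ s₁ s₂ s₃

/-! ### The weighted bound -/

/-- The signed distance `τ - ω(ξ, μ)`, in the variable `τ`, to the characteristic surface. -/
noncomputable def kpModulation (x : ℝ × ℝ × ℝ) : ℝ := x.2.2 - kpOmega x.1 x.2.1

theorem kpOmega_neg (ξ μ : ℝ) : kpOmega (-ξ) (-μ) = -kpOmega ξ μ := by
  unfold kpOmega
  rw [neg_sq, div_neg]
  ring

theorem kpModulation_neg (x : ℝ × ℝ × ℝ) : kpModulation (-x) = -kpModulation x := by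
  simp only [kpModulation, Prod.fst_neg, Prod.snd_neg, kpOmega_neg]
  ring

@[fun_prop]
theorem measurable_kpModulation : Measurable kpModulation := by
  unfold kpModulation kpOmega
  fun_prop

theorem mem_dyadicShell_neg {k : ℤ} {ξ : ℝ} : -ξ ∈ dyadicShell k ↔ ξ ∈ dyadicShell k := by
  simp [dyadicShell]

theorem abs_pos_of_mem_dyadicShell {k : ℤ} {ξ : ℝ} (h : ξ ∈ dyadicShell k) : 0 < |ξ| :=
  lt_of_lt_of_le (by positivity) h.1

theorem abs_le_of_mem_dyadicShell {k : ℤ} {ξ : ℝ} (h : ξ ∈ dyadicShell k) : |ξ| ≤ 2 * 2 ^ k := by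
  rw [← zpow_one_add₀ two_ne_zero, add_comm]
  exact h.2

theorem half_le_abs_of_mem_dyadicShell {k : ℤ} {ξ : ℝ} (h : ξ ∈ dyadicShell k) :
    2 ^ k / 2 ≤ |ξ| := by
  rw [div_eq_mul_inv, ← zpow_sub_one₀ two_ne_zero]
  exact h.1

theorem measurableSet_dyadicShell (k : ℤ) : MeasurableSet (dyadicShell k) :=
  measurableSet_Icc.preimage measurable_abs

theorem mem_kpRegionTop_iff {k : ℤ} {j : ℕ} {x : ℝ × ℝ × ℝ} :
    x ∈ kpRegionTop k j ↔ x.1 ∈ dyadicShell k ∧ |kpModulation x| ≤ 2 ^ j := by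
  simp only [kpRegionTop, kpRegion, Set.mem_iUnion, Set.mem_ofPred_eq, Real.rpow_natCast,
    Real.rpow_intCast, ← kpModulation.eq_1]
  refine ⟨fun ⟨l, h⟩ => ⟨h.1, h.2.2⟩, fun h => ?_⟩
  obtain ⟨n, hn⟩ := pow_unbounded_of_one_lt |x.2.1| one_lt_two
  exact ⟨n, h.1, by exact_mod_cast hn.le, h.2⟩

theorem kpRegionTop_mono {k : ℤ} {i j : ℕ} (hij : i ≤ j) : kpRegionTop k i ⊆ kpRegionTop k j :=
  fun _ hx =>
    have ⟨hshell, hmod⟩ := mem_kpRegionTop_iff.1 hx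
    mem_kpRegionTop_iff.2 ⟨hshell, hmod.trans (pow_le_pow_right₀ one_le_two hij)⟩

theorem kpRegionTop_eq (k : ℤ) (j : ℕ) :
    kpRegionTop k j = Prod.fst ⁻¹' dyadicShell k ∩ {x | |kpModulation x| ≤ 2 ^ j} :=
  Set.ext fun _ => mem_kpRegionTop_iff

theorem neg_kpRegionTop (k : ℤ) (j : ℕ) : -kpRegionTop k j = kpRegionTop k j := by
  ext x
  simp only [Set.mem_neg, mem_kpRegionTop_iff, Prod.fst_neg, mem_dyadicShell_neg,
    kpModulation_neg, abs_neg]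

theorem measurableSet_kpRegionTop (k : ℤ) (j : ℕ) : MeasurableSet (kpRegionTop k j) := by
  rw [kpRegionTop_eq]
  exact (measurable_fst (measurableSet_dyadicShell k)).inter
    (measurableSet_le (by fun_prop) measurable_const)

@[fun_prop]
theorem measurable_kpWeight : Measurable fun x : ℝ × ℝ => kpWeight x.1 x.2 := by
  unfold kpWeight
  fun_prop

theorem one_le_kpWeight (ξ μ : ℝ) : 1 ≤ kpWeight ξ μ :=
  le_add_of_nonneg_right (by positivity)

theorem kpWeight_pos (ξ μ : ℝ) : 0 < kpWeight ξ μ := one_pos.trans_le (one_le_kpWeight ξ μ)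

theorem lintegral_inv_one_add_sq :
    ∫⁻ x : ℝ, ENNReal.ofReal (1 + x ^ 2)⁻¹ = ENNReal.ofReal Real.pi := by
  rw [← ofReal_integral_eq_lintegral_ofReal integrable_inv_one_add_sq
    (Filter.Eventually.of_forall fun x => by positivity), integral_univ_inv_one_add_sq]

theorem lintegral_eq_lintegral_affine {c : ℝ} (hc : c ≠ 0) (d : ℝ) (g : ℝ → ℝ≥0∞) :
    ∫⁻ x, g x = ∫⁻ y, ENNReal.ofReal |c| * g (c * y + d) := by
  have hsurj : (fun y => c * y + d) '' Set.univ = Set.univ :=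
    Set.image_univ_of_surjective fun x => ⟨(x - d) / c, by field_simp; ring⟩
  have hinj : Set.InjOn (fun y => c * y + d) Set.univ := fun x _ y _ hxy => by simpa [hc] using hxy
  have hderiv (y : ℝ) (_ : y ∈ Set.univ) :
      HasDerivWithinAt (fun y => c * y + d) c Set.univ y := by
    simpa using (((hasDerivAt_id y).const_mul c).add_const d).hasDerivWithinAt (s := Set.univ)
  simpa only [hsurj, Measure.restrict_univ] using
    lintegral_image_eq_lintegral_abs_deriv_mul MeasurableSet.univ hderiv hinj g

theorem lintegral_inv_kpWeight_sq_le {ξ : ℝ} (hξ : 0 < |ξ|) :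
    ∫⁻ μ, ENNReal.ofReal (kpWeight ξ μ)⁻¹ ^ 2 ≤ ENNReal.ofReal (Real.pi * (|ξ| + |ξ| ^ 2)) := by
  set A := |ξ| + |ξ| ^ 2 with hA
  have hA0 : 0 < A := by positivity
  have hscaled (y : ℝ) : kpWeight ξ (A * y + 0) = 1 + |y| := by
    rw [kpWeight, add_zero, abs_mul, abs_of_pos hA0, ← hA]
    field_simp
  have hpoint (y : ℝ) : (kpWeight ξ (A * y + 0))⁻¹ ^ 2 ≤ (1 + y ^ 2)⁻¹ := by
    rw [hscaled, inv_pow]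
    gcongr
    nlinarith [abs_nonneg y, sq_abs y]
  rw [lintegral_eq_lintegral_affine hA0.ne' 0, abs_of_pos hA0]
  calc ∫⁻ y, ENNReal.ofReal A * ENNReal.ofReal (kpWeight ξ (A * y + 0))⁻¹ ^ 2
      ≤ ∫⁻ y : ℝ, ENNReal.ofReal A * ENNReal.ofReal (1 + y ^ 2)⁻¹ := by
        gcongr with y
        rw [← ENNReal.ofReal_pow (inv_nonneg.2 (kpWeight_pos _ _).le)]
        exact ENNReal.ofReal_le_ofReal (hpoint y)
    _ = ENNReal.ofReal (Real.pi * A) := by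
        rw [lintegral_const_mul' _ _ ENNReal.ofReal_ne_top, lintegral_inv_one_add_sq,
          ← ENNReal.ofReal_mul hA0.le, mul_comm]

section Weighted

variable {F₁ F₂ F₃ : ℝ × ℝ × ℝ → ℝ≥0∞} {k₁ k₂ k₃ : ℤ} {j₁ j₂ j₃ : ℕ}

theorem support_slice_subset_closedBall {F : ℝ × ℝ × ℝ → ℝ≥0∞} {k : ℤ} {j : ℕ}
    (hF : F.support ⊆ kpRegionTop k j) (ξ μ : ℝ) :
    (fun τ => F (ξ, μ, τ)).support ⊆ Metric.closedBall (kpOmega ξ μ) (2 ^ j) := fun _ hτ =>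
  (mem_kpRegionTop_iff.1 (hF hτ)).2

theorem support_sliceL2Norm_subset_closedBall {F : ℝ × ℝ × ℝ → ℝ≥0∞} {k : ℤ} {j : ℕ}
    (hF : F.support ⊆ kpRegionTop k j) :
    (sliceL2Norm F).support ⊆ Metric.closedBall 0 (2 * 2 ^ k) :=
  support_sliceL2Norm_subset fun x hx => by
    simpa using abs_le_of_mem_dyadicShell (mem_kpRegionTop_iff.1 (hF hx)).1

theorem sq_trilinearForm_slice_le_weighted (h₁ : Measurable F₁) (h₂ : Measurable F₂)
    (h₃ : Measurable F₃) (s₁ : F₁.support ⊆ kpRegionTop k₁ j₁)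
    (s₂ : F₂.support ⊆ kpRegionTop k₂ j₂) (s₃ : F₃.support ⊆ kpRegionTop k₃ j₃) (ξ ξ' : ℝ) :
    trilinearForm (fun b => F₁ (ξ, b)) (fun b => F₂ (ξ', b)) (fun b => F₃ (-(ξ + ξ'), b)) ^ 2 ≤
      ENNReal.ofReal (2 * min (2 ^ j₁) (min (2 ^ j₂) (2 ^ j₃)) *
        (Real.pi * (2 * 2 ^ k₁ + (2 * 2 ^ k₁) ^ 2))) *
      (∫⁻ b : ℝ × ℝ, (ENNReal.ofReal (kpWeight ξ b.1) * F₁ (ξ, b)) ^ 2) *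
      (∫⁻ b, F₂ (ξ', b) ^ 2) * ∫⁻ b, F₃ (-(ξ + ξ'), b) ^ 2 := by
  by_cases hξ : ξ ∈ dyadicShell k₁
  swap
  · have hF₁ (b : ℝ × ℝ) : F₁ (ξ, b) = 0 :=
      Function.notMem_support.1 fun h => hξ (mem_kpRegionTop_iff.1 (s₁ h)).1
    simp [trilinearForm, hF₁]
  have hweight : (∫⁻ μ, sliceL2Norm (fun b => F₁ (ξ, b)) μ) ^ 2 ≤
      ENNReal.ofReal (Real.pi * (2 * 2 ^ k₁ + (2 * 2 ^ k₁) ^ 2)) *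
        ∫⁻ b : ℝ × ℝ, (ENNReal.ofReal (kpWeight ξ b.1) * F₁ (ξ, b)) ^ 2 := by
    refine (sq_lintegral_sliceL2Norm_le (w := kpWeight ξ) (by fun_prop) (by fun_prop)
      (kpWeight_pos ξ)).trans ?_
    gcongr
    refine (lintegral_inv_kpWeight_sq_le (abs_pos_of_mem_dyadicShell hξ)).trans ?_
    have := abs_le_of_mem_dyadicShell hξ
    gcongr
  refine (sq_trilinearForm_prod_le_lintegral (by fun_prop) (by fun_prop) (by fun_prop)
    fun μ μ' => sq_trilinearForm_le_of_support_closedBall (by fun_prop) (by fun_prop)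
      (by fun_prop) (support_slice_subset_closedBall s₁ ξ μ)
      (support_slice_subset_closedBall s₂ ξ' μ') (support_slice_subset_closedBall s₃ _ _)).trans ?_
  grw [hweight]
  rw [ENNReal.ofReal_mul (p := 2 * min (2 ^ j₁) (min (2 ^ j₂) (2 ^ j₃))) (by positivity)]
  exact le_of_eq (by ring)

/-- In each of the variables `τ` and `ξ` the smallest of the three supports is used; in `μ`, where
the supports are unbounded, the weight is. -/
theorem sq_trilinearForm_le_weighted (h₁ : Measurable F₁) (h₂ : Measurable F₂)
    (h₃ : Measurable F₃) (s₁ : F₁.support ⊆ kpRegionTop k₁ j₁)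
    (s₂ : F₂.support ⊆ kpRegionTop k₂ j₂) (s₃ : F₃.support ⊆ kpRegionTop k₃ j₃) :
    trilinearForm F₁ F₂ F₃ ^ 2 ≤
      ENNReal.ofReal (8 * Real.pi * (2 * 2 ^ k₁ + (2 * 2 ^ k₁) ^ 2) *
        min (2 ^ k₁) (min (2 ^ k₂) (2 ^ k₃)) * min (2 ^ j₁) (min (2 ^ j₂) (2 ^ j₃))) *
      (∫⁻ x, (ENNReal.ofReal (kpWeight x.1 x.2.1) * F₁ x) ^ 2) *
      (∫⁻ x, F₂ x ^ 2) * ∫⁻ x, F₃ x ^ 2 := by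
  set P : ℝ × ℝ × ℝ → ℝ≥0∞ := fun x => ENNReal.ofReal (kpWeight x.1 x.2.1) * F₁ x
  have hP : Measurable P := by fun_prop
  have sP : P.support ⊆ kpRegionTop k₁ j₁ := (Function.support_mul_subset_right _ _).trans s₁
  refine (sq_trilinearForm_prod_le h₁ h₂ h₃ (G := sliceL2Norm P) (by fun_prop) fun ξ ξ' => by
    simpa only [sq_sliceL2Norm] using
      sq_trilinearForm_slice_le_weighted h₁ h₂ h₃ s₁ s₂ s₃ ξ ξ').trans ?_
  grw [sq_trilinearForm_le_of_support_closedBall (by fun_prop) (by fun_prop) (by fun_prop)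
    (support_sliceL2Norm_subset_closedBall sP) (support_sliceL2Norm_subset_closedBall s₂)
    (support_sliceL2Norm_subset_closedBall s₃)]
  simp only [lintegral_sq_sliceL2Norm hP, lintegral_sq_sliceL2Norm h₂,
    lintegral_sq_sliceL2Norm h₃, ← mul_assoc]
  rw [← ENNReal.ofReal_mul (by positivity)]
  simp only [← mul_min_of_nonneg _ _ (zero_le_two (α := ℝ))]
  refine le_of_eq ?_
  congr 4
  ring

end Weighted

/-! ### The Strichartz bound -/

theorem volume_setOf_sq_mem_Icc_le (B : ℝ) {δ : ℝ} (hδ : 0 ≤ δ) :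
    volume {v : ℝ | v ^ 2 ∈ Set.Icc (B - 2 * δ) B} ≤ ENNReal.ofReal (4 * δ / √B) := by
  rcases le_or_gt B 0 with hB | hB
  · have hzero : {v : ℝ | v ^ 2 ∈ Set.Icc (B - 2 * δ) B} ⊆ {0} := fun v hv => by
      simpa using le_antisymm (hv.2.trans hB) (sq_nonneg v)
    exact (measure_mono_null hzero (measure_singleton 0)).trans_le zero_le
  have hr : 0 < √B := Real.sqrt_pos.2 hB
  have hrB : √B ^ 2 = B := Real.sq_sqrt hB.le
  set r := √B
  set s := r - 2 * δ / r with hs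
  have hsr : s * r = r ^ 2 - 2 * δ := by rw [hs]; field_simp
  have hsub : {v : ℝ | v ^ 2 ∈ Set.Icc (B - 2 * δ) B} ⊆ Set.Icc s r ∪ Set.Icc (-r) (-s) := by
    rintro v ⟨hv_lower, hv_upper⟩
    have hvr : |v| ≤ r := abs_le_of_sq_le_sq (hrB ▸ hv_upper) hr.le
    have hsv : s ≤ |v| := by
      by_contra! h
      rw [← sq_abs, ← hrB, ← hsr] at hv_lower
      nlinarith [abs_nonneg v]
    rcases abs_cases v with ⟨h, _⟩ | ⟨h, _⟩
    · left; constructor <;> linarith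
    · right; constructor <;> linarith
  have hδr : 0 ≤ 2 * δ / r := by positivity
  refine (measure_mono hsub).trans ((measure_union_le _ _).trans ?_)
  rw [Real.volume_Icc, Real.volume_Icc, ← ENNReal.ofReal_add (by linarith) (by linarith)]
  exact ENNReal.ofReal_le_ofReal (le_of_eq (by rw [hs]; ring))

theorem lintegral_inv_sqrt_one_sub_sq :
    ∫⁻ t : ℝ, ENNReal.ofReal (√(1 - t ^ 2))⁻¹ = ENNReal.ofReal Real.pi := by
  have hsupp : (fun t : ℝ => ENNReal.ofReal (√(1 - t ^ 2))⁻¹).support ⊆ Set.Ioc (-1) 1 :=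
    fun t ht => by
      have ht_lt : t ^ 2 < 1 := by simpa using ht
      exact Set.Ioo_subset_Ioc_self (abs_lt.1 (by simpa using ht_lt))
  have hreal : Polynomial.Chebyshev.measureT.real Set.univ = Real.pi := by
    simpa using Polynomial.Chebyshev.integral_eval_T_real_measureT_zero
  have htop : Polynomial.Chebyshev.measureT Set.univ ≠ ∞ := fun h =>
    Real.pi_ne_zero (by simp [← hreal, measureReal_def, h])
  rw [← hreal, ofReal_measureReal htop, ← setLIntegral_eq_of_support_subset hsupp,
    Polynomial.Chebyshev.measureT, Measure.restrict_apply_univ,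
    withDensity_apply _ measurableSet_Ioc]
  refine lintegral_congr fun t => ?_
  rw [← Real.sqrt_inv]
  exact ENNReal.ofReal_eq_coe_nnreal _

theorem lintegral_inv_sqrt_sub_sq_le (R : ℝ) :
    ∫⁻ t : ℝ, ENNReal.ofReal (√(R - t ^ 2))⁻¹ ≤ ENNReal.ofReal Real.pi := by
  rcases le_or_gt R 0 with hR | hR
  · have hzero (t : ℝ) : √(R - t ^ 2) = 0 :=
      Real.sqrt_eq_zero_of_nonpos (by linarith [sq_nonneg t])
    simp [hzero]
  have hr : 0 < √R := Real.sqrt_pos.2 hR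
  rw [lintegral_eq_lintegral_affine hr.ne' 0, abs_of_pos hr, ← lintegral_inv_sqrt_one_sub_sq]
  refine (lintegral_congr fun y => ?_).le
  rw [← ENNReal.ofReal_mul hr.le, add_zero, mul_pow, Real.sq_sqrt hR.le, ← mul_one_sub,
    Real.sqrt_mul hR.le, mul_inv, mul_inv_cancel_left₀ hr.ne']

/-- The sum of `ω` over two frequencies, one of them `p`, which add up to `(ξ, μ)`. -/
noncomputable def kpPhase (ξ μ : ℝ) (p : ℝ × ℝ) : ℝ :=
  kpOmega p.1 p.2 + kpOmega (ξ - p.1) (μ - p.2)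

theorem kpPhase_eq {x ξ : ℝ} (hx : x ∈ Set.Ioo 0 ξ) (μ y : ℝ) :
    kpPhase ξ μ (x, y) = kpOmega ξ μ +
      (y - μ * x / ξ) ^ 2 / (x * (ξ - x) / ξ) - 3 * ξ * (x * (ξ - x)) := by
  have hx₀ : x ≠ 0 := hx.1.ne'
  have hx₁ : ξ - x ≠ 0 := (sub_pos.2 hx.2).ne'
  have hξ : ξ ≠ 0 := (hx.1.trans hx.2).ne'
  unfold kpPhase kpOmega
  field_simp
  ring

@[fun_prop]
theorem measurable_kpPhase (ξ μ : ℝ) : Measurable (kpPhase ξ μ) := by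
  unfold kpPhase kpOmega
  fun_prop

theorem div_sqrt_le_inv_sqrt {ξ s : ℝ} (hξ : 0 < ξ) (hs : 0 < s) (hsξ : s ≤ ξ ^ 2) (m : ℝ) :
    s / ξ / √(s / ξ * (m + 3 * ξ * s)) ≤ (√(s + min m 0 / (3 * ξ)))⁻¹ := by
  set q := s + min m 0 / (3 * ξ) with hq
  have hξq : 3 * ξ * q = 3 * ξ * s + min m 0 := by rw [hq]; field_simp
  have ha : 0 < s / ξ := by positivity
  rcases le_or_gt q 0 with hq₀ | hq₀
  · have hm : m < 0 := by
      by_contra! hm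
      rw [min_eq_right hm] at hξq
      nlinarith [mul_pos hξ hs]
    rw [min_eq_left hm.le] at hξq
    rw [add_comm m, ← hξq, Real.sqrt_eq_zero_of_nonpos hq₀, Real.sqrt_eq_zero_of_nonpos
      (mul_nonpos_of_nonneg_of_nonpos ha.le (by nlinarith))]
    simp
  · have haξ : s / ξ ≤ ξ := by rwa [div_le_iff₀ hξ, ← sq]
    have hlower : (s / ξ) ^ 2 * q ≤ s / ξ * (m + 3 * ξ * s) :=
      calc (s / ξ) ^ 2 * q ≤ s / ξ * (3 * ξ * q) := by
            rw [sq, mul_assoc]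
            gcongr
            linarith
        _ ≤ s / ξ * (m + 3 * ξ * s) := by
            gcongr
            linarith [min_le_left m 0]
    have hpos : 0 < √(s / ξ * (m + 3 * ξ * s)) :=
      Real.sqrt_pos.2 (lt_of_lt_of_le (by positivity) hlower)
    rw [div_le_iff₀ hpos, ← div_eq_inv_mul, le_div_iff₀ (Real.sqrt_pos.2 hq₀)]
    refine Real.le_sqrt_of_sq_le ?_
    rwa [mul_pow, Real.sq_sqrt hq₀.le]

theorem volume_kpPhase_slice_le {x ξ : ℝ} (hx : x ∈ Set.Ioo 0 ξ) (μ τ : ℝ) {M : ℝ} (hM : 0 ≤ M) :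
    volume {y | |τ - kpPhase ξ μ (x, y)| ≤ M} ≤ ENNReal.ofReal (4 * M) * ENNReal.ofReal
      (√(x * (ξ - x) + min (τ - kpOmega ξ μ + M) 0 / (3 * ξ)))⁻¹ := by
  have hx₁ : 0 < ξ - x := sub_pos.2 hx.2
  have hξ : 0 < ξ := hx.1.trans hx.2
  have hs : 0 < x * (ξ - x) := mul_pos hx.1 hx₁
  set s := x * (ξ - x) with hs_def
  set m := τ - kpOmega ξ μ + M with hm
  set B := s / ξ * (m + 3 * ξ * s) with hB
  have hsub : {y | |τ - kpPhase ξ μ (x, y)| ≤ M} ⊆ (fun y => y + -(μ * x / ξ)) ⁻¹'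
      {v : ℝ | v ^ 2 ∈ Set.Icc (B - 2 * (s / ξ * M)) B} := fun y hy => by
    rw [Set.mem_ofPred_eq, kpPhase_eq hx, ← hs_def, abs_le] at hy
    have hsq : s / ξ * ((y - μ * x / ξ) ^ 2 / (s / ξ)) = (y + -(μ * x / ξ)) ^ 2 := by
      rw [← sub_eq_add_neg]
      field_simp
    have h₁ := mul_le_mul_of_nonneg_left hy.1 (by positivity : 0 ≤ s / ξ)
    have h₂ := mul_le_mul_of_nonneg_left hy.2 (by positivity : 0 ≤ s / ξ)
    rw [Set.mem_preimage, Set.mem_ofPred_eq, ← hsq, hB, hm]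
    constructor <;> linarith
  calc volume {y | |τ - kpPhase ξ μ (x, y)| ≤ M}
      ≤ ENNReal.ofReal (4 * (s / ξ * M) / √B) := by
        refine (measure_mono hsub).trans ?_
        rw [measure_preimage_add_right]
        exact volume_setOf_sq_mem_Icc_le B (by positivity)
    _ = ENNReal.ofReal (4 * M) * ENNReal.ofReal (s / ξ / √B) := by
        rw [← ENNReal.ofReal_mul (by positivity)]
        congr 1
        ring
    _ ≤ _ := by
        gcongr
        exact div_sqrt_le_inv_sqrt hξ hs (by nlinarith [hx.1]) m

theorem volume_kpPhase_le (ξ μ τ : ℝ) {M : ℝ} (hM : 0 ≤ M) :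
    volume {p : ℝ × ℝ | p.1 ∈ Set.Ioo 0 ξ ∧ |τ - kpPhase ξ μ p| ≤ M} ≤
      ENNReal.ofReal (4 * M) * ENNReal.ofReal Real.pi := by
  set R := ξ ^ 2 / 4 + min (τ - kpOmega ξ μ + M) 0 / (3 * ξ) with hR
  have hmeas : MeasurableSet {p : ℝ × ℝ | p.1 ∈ Set.Ioo 0 ξ ∧ |τ - kpPhase ξ μ p| ≤ M} :=
    (measurable_fst measurableSet_Ioo).inter
      (measurableSet_le (measurable_const.sub (measurable_kpPhase ξ μ)).abs measurable_const)
  rw [Measure.volume_eq_prod, Measure.prod_apply hmeas]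
  calc ∫⁻ x, volume (Prod.mk x ⁻¹' {p | p.1 ∈ Set.Ioo 0 ξ ∧ |τ - kpPhase ξ μ p| ≤ M})
      ≤ ∫⁻ x, ENNReal.ofReal (4 * M) * ENNReal.ofReal (√(R - (x - ξ / 2) ^ 2))⁻¹ := by
        refine lintegral_mono fun x => ?_
        by_cases hx : x ∈ Set.Ioo 0 ξ
        · refine (measure_mono fun y hy => hy.2).trans
            ((volume_kpPhase_slice_le hx μ τ hM).trans_eq ?_)
          congr 4
          rw [hR]
          ring
        · rw [show Prod.mk x ⁻¹' {p | p.1 ∈ Set.Ioo 0 ξ ∧ |τ - kpPhase ξ μ p| ≤ M} = ∅ from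
            Set.eq_empty_of_forall_notMem fun y hy => hx hy.1, measure_empty]
          exact zero_le
    _ = ENNReal.ofReal (4 * M) * ∫⁻ x : ℝ, ENNReal.ofReal (√(R - x ^ 2))⁻¹ := by
        rw [lintegral_const_mul' _ _ ENNReal.ofReal_ne_top,
          lintegral_sub_right_eq_self fun x : ℝ => ENNReal.ofReal (√(R - x ^ 2))⁻¹]
    _ ≤ _ := by grw [lintegral_inv_sqrt_sub_sq_le R]

theorem volume_le_mul_of_slice {α β γ : Type*} [MeasureSpace α] [MeasureSpace β] [MeasureSpace γ]
    [SFinite (volume : Measure α)] [SFinite (volume : Measure β)] [SFinite (volume : Measure γ)]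
    {E : Set (α × β × γ)} (hE : MeasurableSet E) {A : Set (α × β)}
    (hEA : ∀ x ∈ E, (x.1, x.2.1) ∈ A) {m : ℝ≥0∞}
    (hm : ∀ a b, volume {c | (a, b, c) ∈ E} ≤ m) : volume E ≤ m * volume A := by
  have hpres : MeasurePreserving (MeasurableEquiv.prodAssoc : (α × β) × γ ≃ᵐ α × β × γ) :=
    volume_preserving_prodAssoc
  rw [← hpres.measure_preimage_equiv, Measure.volume_eq_prod,
    Measure.prod_apply (hpres.measurable hE)]
  refine le_trans (lintegral_mono fun p => ?_) (lintegral_indicator_const_le A m)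
  by_cases hp : p ∈ A
  · exact (hm p.1 p.2).trans_eq (Set.indicator_of_mem hp fun _ => m).symm
  · have hempty : Prod.mk p ⁻¹' (MeasurableEquiv.prodAssoc ⁻¹' E) = ∅ :=
      Set.eq_empty_of_forall_notMem fun c hc => hp (hEA (p.1, p.2, c) hc)
    rw [hempty, measure_empty]
    exact zero_le

/-- The points `t` such that `t` and `x - t` have positive frequencies and modulations at most
`J₁` and `J₂`. -/
def kpFiber (J₁ J₂ : ℝ) (x : ℝ × ℝ × ℝ) : Set (ℝ × ℝ × ℝ) :=
  {t | t.1 ∈ Set.Ioo 0 x.1 ∧ |kpModulation t| ≤ J₁ ∧ |kpModulation (x - t)| ≤ J₂}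

theorem measurableSet_kpFiber (J₁ J₂ : ℝ) (x : ℝ × ℝ × ℝ) : MeasurableSet (kpFiber J₁ J₂ x) :=
  (measurable_fst measurableSet_Ioo).inter
    ((measurableSet_le measurable_kpModulation.abs measurable_const).inter
      (measurableSet_le (measurable_kpModulation.comp (measurable_const.sub measurable_id)).abs
        measurable_const))

theorem volume_kpFiber_le {J₁ J₂ : ℝ} (hJ₁ : 0 ≤ J₁) (hJ₂ : 0 ≤ J₂) (x : ℝ × ℝ × ℝ) :
    volume (kpFiber J₁ J₂ x) ≤ ENNReal.ofReal (16 * Real.pi * J₁ * J₂) := by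
  have hphase (t) (ht : t ∈ kpFiber J₁ J₂ x) :
      (t.1, t.2.1) ∈ {p : ℝ × ℝ | p.1 ∈ Set.Ioo 0 x.1 ∧
        |x.2.2 - kpPhase x.1 x.2.1 p| ≤ J₁ + J₂} := by
    refine ⟨ht.1, ?_⟩
    calc |x.2.2 - kpPhase x.1 x.2.1 (t.1, t.2.1)| = |kpModulation t + kpModulation (x - t)| := by
          simp only [kpPhase, kpModulation, Prod.fst_sub, Prod.snd_sub]
          ring_nf
      _ ≤ J₁ + J₂ := (abs_add_le _ _).trans (add_le_add ht.2.1 ht.2.2)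
  have hslice (ξ μ : ℝ) : volume {τ | (ξ, μ, τ) ∈ kpFiber J₁ J₂ x} ≤
      ENNReal.ofReal (2 * min J₁ J₂) := by
    rcases min_choice J₁ J₂ with h | h <;> rw [h]
    · rw [← Real.volume_closedBall (kpOmega ξ μ)]
      exact measure_mono fun τ hτ => hτ.2.1
    · rw [← Real.volume_closedBall (x.2.2 - kpOmega (x.1 - ξ) (x.2.1 - μ))]
      refine measure_mono fun τ hτ => ?_
      rw [Metric.mem_closedBall', Real.dist_eq, sub_right_comm]
      exact hτ.2.2
  refine (volume_le_mul_of_slice (measurableSet_kpFiber J₁ J₂ x) hphase hslice).trans ?_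
  grw [volume_kpPhase_le _ _ _ (add_nonneg hJ₁ hJ₂)]
  rw [← ENNReal.ofReal_mul (by positivity), ← ENNReal.ofReal_mul (by positivity)]
  refine ENNReal.ofReal_le_ofReal ?_
  have hmin : min J₁ J₂ * (J₁ + J₂) ≤ 2 * (J₁ * J₂) := by
    rw [← min_add_max J₁ J₂, ← min_mul_max J₁ J₂]
    nlinarith [min_le_max (a := J₁) (b := J₂), le_min hJ₁ hJ₂]
  nlinarith [Real.pi_pos]

instance volume_real_prod_real_prod_real_isAddHaarMeasure :
    (volume : Measure (ℝ × ℝ × ℝ)).IsAddHaarMeasure :=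
  Measure.prod.instIsAddHaarMeasure volume volume

/-- The second factor splits into one supported in `S` and the reflection of such a function. -/
theorem lintegral_sq_lconvolution_le_of_support_subset_union_neg {α : Type*} [MeasureSpace α]
    [AddCommGroup α] [MeasurableAdd₂ α] [MeasurableNeg α] [SFinite (volume : Measure α)]
    [(volume : Measure α).IsAddLeftInvariant] [(volume : Measure α).IsNegInvariant]
    {F₁ F₂ : α → ℝ≥0∞} (h₁ : Measurable F₁) (h₂ : Measurable F₂) {S : Set α}
    (hS : MeasurableSet S) (s₂ : F₂.support ⊆ S ∪ -S) {B : ℝ≥0∞}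
    (hB : ∀ G : α → ℝ≥0∞, Measurable G → G.support ⊆ S →
      ∫⁻ x, (F₁ ⋆ₗ G) x ^ 2 ≤ B * ∫⁻ x, G x ^ 2) :
    ∫⁻ x, (F₁ ⋆ₗ F₂) x ^ 2 ≤ 4 * B * ∫⁻ x, F₂ x ^ 2 := by
  set P := S.indicator F₂
  set N := Sᶜ.indicator F₂
  have hP : Measurable P := h₂.indicator hS
  have hN : Measurable N := h₂.indicator hS.compl
  have hPbound : ∫⁻ x, (F₁ ⋆ₗ P) x ^ 2 ≤ B * ∫⁻ x, F₂ x ^ 2 := by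
    grw [hB P hP Set.support_indicator_subset]
    gcongr with x
    exact Set.indicator_le_self _ _ x
  have hNbound : ∫⁻ x, (F₁ ⋆ₗ N) x ^ 2 ≤ B * ∫⁻ x, F₂ x ^ 2 := by
    have hNsupp : (fun x => N (-x)).support ⊆ S := fun x hx => by
      have hx' : -x ∈ Sᶜ ∩ F₂.support := by rwa [← Set.support_indicator]
      simpa using (s₂ hx'.2).resolve_left hx'.1
    rw [← lintegral_sq_lconvolution_comp_neg h₁ hN]
    grw [hB _ (by fun_prop) hNsupp, lintegral_neg_eq_self fun x => N x ^ 2]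
    gcongr with x
    exact Set.indicator_le_self _ _ x
  have hsplit (x : α) : (F₁ ⋆ₗ F₂) x = (F₁ ⋆ₗ P) x + (F₁ ⋆ₗ N) x := by
    simp only [lconvolution_def]
    rw [← lintegral_add_left (by fun_prop)]
    simp only [← mul_add, P, N, Set.indicator_self_add_compl_apply]
  calc ∫⁻ x, (F₁ ⋆ₗ F₂) x ^ 2 ≤ ∫⁻ x, 2 * ((F₁ ⋆ₗ P) x ^ 2 + (F₁ ⋆ₗ N) x ^ 2) := by
        gcongr with x
        rw [hsplit]
        exact ennreal_add_sq_le _ _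
    _ = 2 * ((∫⁻ x, (F₁ ⋆ₗ P) x ^ 2) + ∫⁻ x, (F₁ ⋆ₗ N) x ^ 2) := by
        rw [lintegral_const_mul' _ _ (by simp), lintegral_add_left (by fun_prop)]
    _ ≤ 2 * (B * (∫⁻ x, F₂ x ^ 2) + B * ∫⁻ x, F₂ x ^ 2) := by gcongr
    _ = _ := by ring

/-- The points of positive frequency and modulation at most `J`. -/
def posModulationLE (J : ℝ) : Set (ℝ × ℝ × ℝ) := {x | 0 < x.1 ∧ |kpModulation x| ≤ J}

theorem measurableSet_posModulationLE (J : ℝ) : MeasurableSet (posModulationLE J) :=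
  (measurable_fst measurableSet_Ioi).inter
    (measurableSet_le measurable_kpModulation.abs measurable_const)

theorem mem_posModulationLE_union_neg {J : ℝ} {x : ℝ × ℝ × ℝ} :
    x ∈ posModulationLE J ∪ -posModulationLE J ↔ x.1 ≠ 0 ∧ |kpModulation x| ≤ J := by
  simp only [posModulationLE, Set.mem_union, Set.mem_neg, Set.mem_ofPred_eq, Prod.fst_neg,
    kpModulation_neg, abs_neg, Left.neg_pos_iff, ne_iff_gt_or_lt, or_and_right]

section Strichartz

variable {F₁ F₂ : ℝ × ℝ × ℝ → ℝ≥0∞} {J₁ J₂ : ℝ}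

theorem lintegral_sq_lconvolution_le_of_pos (h₁ : Measurable F₁) (h₂ : Measurable F₂)
    (hJ₁ : 0 ≤ J₁) (hJ₂ : 0 ≤ J₂) (s₁ : F₁.support ⊆ posModulationLE J₁)
    (s₂ : F₂.support ⊆ posModulationLE J₂) :
    ∫⁻ x, (F₁ ⋆ₗ F₂) x ^ 2 ≤
      ENNReal.ofReal (16 * Real.pi * J₁ * J₂) * (∫⁻ x, F₁ x ^ 2) * ∫⁻ x, F₂ x ^ 2 := by
  refine lintegral_sq_lconvolution_le_of_fiber h₁ h₂ (fun x t ht => ?_) (volume_kpFiber_le hJ₁ hJ₂)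
  have ht₁ := s₁ (left_ne_zero_of_mul ht)
  have ht₂ := s₂ (right_ne_zero_of_mul ht)
  rw [neg_add_eq_sub] at ht₂
  exact ⟨⟨ht₁.1, sub_pos.1 ht₂.1⟩, ht₁.2, ht₂.2⟩

/-- The bilinear form of the `L⁴` Strichartz estimate, on the Fourier side. -/
theorem lintegral_sq_lconvolution_le_of_modulation (h₁ : Measurable F₁) (h₂ : Measurable F₂)
    (hJ₁ : 0 ≤ J₁) (hJ₂ : 0 ≤ J₂)
    (s₁ : F₁.support ⊆ {x | x.1 ≠ 0 ∧ |kpModulation x| ≤ J₁})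
    (s₂ : F₂.support ⊆ {x | x.1 ≠ 0 ∧ |kpModulation x| ≤ J₂}) :
    ∫⁻ x, (F₁ ⋆ₗ F₂) x ^ 2 ≤
      ENNReal.ofReal (256 * Real.pi * J₁ * J₂) * (∫⁻ x, F₁ x ^ 2) * ∫⁻ x, F₂ x ^ 2 := by
  simp only [← mem_posModulationLE_union_neg, Set.ofPred_mem_eq] at s₁ s₂
  have hpos (G : ℝ × ℝ × ℝ → ℝ≥0∞) (hG : Measurable G) (sG : G.support ⊆ posModulationLE J₁) :
      ∫⁻ x, (G ⋆ₗ F₂) x ^ 2 ≤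
        4 * (ENNReal.ofReal (16 * Real.pi * J₁ * J₂) * ∫⁻ x, G x ^ 2) * ∫⁻ x, F₂ x ^ 2 :=
    lintegral_sq_lconvolution_le_of_support_subset_union_neg hG h₂
      (measurableSet_posModulationLE J₂) s₂ fun G' hG' sG' =>
        lintegral_sq_lconvolution_le_of_pos hG hG' hJ₁ hJ₂ sG sG'
  rw [lconvolution_comm]
  refine (lintegral_sq_lconvolution_le_of_support_subset_union_neg h₂ h₁
    (measurableSet_posModulationLE J₁) s₁
    (B := 4 * ENNReal.ofReal (16 * Real.pi * J₁ * J₂) * ∫⁻ x, F₂ x ^ 2)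
    fun G hG sG => ?_).trans_eq ?_
  · rw [lconvolution_comm]
    exact (hpos G hG sG).trans_eq (by ring)
  · rw [show 256 * Real.pi * J₁ * J₂ = 16 * (16 * Real.pi * J₁ * J₂) by ring,
      ENNReal.ofReal_mul (p := 16) (by norm_num), ENNReal.ofReal_ofNat]
    ring

end Strichartz

/-! ### Resonant interactions -/

theorem setLIntegral_mul_comp_le_of_injOn {f f' : ℝ → ℝ} {S : Set ℝ} (hS : MeasurableSet S)
    (hf : ∀ x ∈ S, HasDerivAt f (f' x) x) (hinj : S.InjOn f) {a : ℝ → ℝ} {C : ℝ} (hC : 0 ≤ C)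
    (ha : ∀ x ∈ S, a x ≤ C * |f' x|) (g : ℝ → ℝ≥0∞) :
    ∫⁻ x in S, ENNReal.ofReal (a x) * g (f x) ≤ ENNReal.ofReal C * ∫⁻ t, g t := by
  calc ∫⁻ x in S, ENNReal.ofReal (a x) * g (f x)
      ≤ ∫⁻ x in S, ENNReal.ofReal C * (ENNReal.ofReal |f' x| * g (f x)) := by
        refine setLIntegral_mono' hS fun x hx => ?_
        rw [← mul_assoc, ← ENNReal.ofReal_mul hC]
        gcongr
        exact ha x hx
    _ = ENNReal.ofReal C * ∫⁻ t in f '' S, g t := by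
        rw [lintegral_const_mul' _ _ ENNReal.ofReal_ne_top,
          lintegral_image_eq_lintegral_abs_deriv_mul hS
            (fun x hx => (hf x hx).hasDerivWithinAt) hinj]
    _ ≤ _ := by gcongr; exact Measure.restrict_le_self

section Resonance

variable {σ R ξ m : ℝ}

theorem one_le_abs_of_sq_eq_three (hσ : σ ^ 2 = 3) : 1 ≤ |σ| := by
  rw [← sq_abs] at hσ
  nlinarith [abs_nonneg σ]

theorem abs_le_two_of_sq_eq_three (hσ : σ ^ 2 = 3) : |σ| ≤ 2 := by
  rw [← sq_abs] at hσ
  nlinarith [abs_nonneg σ]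

/-- The resonance function of an interaction of output frequency `ξ`, in the coordinate `w` with
`ξ₂ = m / w`; see `kpChart_add_kpChart`. -/
noncomputable def resonanceAt (σ ξ m w : ℝ) : ℝ := m / ξ * ((ξ - m / w) * (w - 2 * σ * ξ))

theorem hasDerivAt_resonanceAt (hξ : ξ ≠ 0) {w : ℝ} (hw : w ≠ 0) :
    HasDerivAt (resonanceAt σ ξ m) (m / w * (w - 2 * σ * (m / w))) w := by
  have hfreq : HasDerivAt (fun w => ξ - m / w) (m / w ^ 2) w := by
    refine (((hasDerivAt_inv hw).const_mul m).const_sub ξ).congr_deriv ?_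
    field_simp
  have hslope : HasDerivAt (fun w => w - 2 * σ * ξ) 1 w := (hasDerivAt_id w).sub_const _
  refine ((hfreq.mul hslope).const_mul (m / ξ)).congr_deriv ?_
  field_simp
  ring

/-- The values of `w` for which the slopes are within `R` of each other and the first frequency
`ξ - m / w` is at least `R` in size. -/
def resonantSet (σ R ξ m : ℝ) : Set ℝ :=
  {w | w ≠ 0 ∧ |w - 2 * σ * ξ| ≤ R ∧ R ≤ |ξ - m / w|}

theorem measurableSet_resonantSet (σ R ξ m : ℝ) : MeasurableSet (resonantSet σ R ξ m) :=
  (measurableSet_singleton 0).compl.inter <|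
    (measurableSet_le (by fun_prop : Measurable fun w : ℝ => |w - 2 * σ * ξ|)
      measurable_const).inter <|
    measurableSet_le measurable_const (by fun_prop : Measurable fun w => |ξ - m / w|)

variable {w : ℝ}

theorem abs_le_abs_of_mem_resonantSet (hσ : σ ^ 2 = 3) (hRξ : R ≤ |ξ|)
    (hw : w ∈ resonantSet σ R ξ m) : |ξ| ≤ |w| := by
  have htri : |2 * σ * ξ| ≤ |w| + |w - 2 * σ * ξ| := by simpa using abs_sub w (w - 2 * σ * ξ)
  rw [abs_mul, abs_mul, abs_two] at htri
  nlinarith [abs_nonneg ξ, one_le_abs_of_sq_eq_three hσ, hw.2.1]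

theorem abs_sub_le_abs_of_mem_resonantSet (hσ : σ ^ 2 = 3) (hw : w ∈ resonantSet σ R ξ m) :
    |ξ - m / w| ≤ |w - 2 * σ * (m / w)| := by
  have htri : |2 * σ * (ξ - m / w)| ≤ |w - 2 * σ * (m / w)| + |w - 2 * σ * ξ| := by
    rw [show 2 * σ * (ξ - m / w) = (w - 2 * σ * (m / w)) - (w - 2 * σ * ξ) by ring]
    exact abs_sub _ _
  rw [abs_mul, abs_mul, abs_two] at htri
  nlinarith [abs_nonneg (ξ - m / w), one_le_abs_of_sq_eq_three hσ, hw.2.1, hw.2.2]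

theorem mul_pos_of_mem_resonantSet (hσ : σ ^ 2 = 3) (hR : 0 < R)
    (hw : w ∈ resonantSet σ R ξ m) : 0 < (w - 2 * σ * (m / w)) * (σ * (ξ - m / w)) := by
  obtain ⟨-, hslope, hfreq⟩ := hw
  have hexpand : (w - 2 * σ * (m / w)) * (σ * (ξ - m / w)) =
      6 * |ξ - m / w| ^ 2 + (w - 2 * σ * ξ) * (σ * (ξ - m / w)) := by
    rw [sq_abs]
    linear_combination (2 * (ξ - m / w) ^ 2) * hσ
  have herror : |(w - 2 * σ * ξ) * (σ * (ξ - m / w))| ≤ |ξ - m / w| * (2 * |ξ - m / w|) := by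
    rw [abs_mul, abs_mul]
    gcongr ?_ * (?_ * _)
    · exact hslope.trans hfreq
    · exact abs_le_two_of_sq_eq_three hσ
  rw [hexpand]
  nlinarith [(abs_le.1 herror).1, hR.trans_le hfreq]

/-- If `w ≠ w'` have the same resonance then `w w' = 2 σ m`, so `w - 2 σ (m / w) = w - w'` and
`w' - 2 σ (m / w') = w' - w` have opposite signs, against `mul_pos_of_mem_resonantSet`. -/
theorem injOn_resonanceAt (hσ : σ ^ 2 = 3) (hR : 0 < R) (hξ : ξ ≠ 0) (hm : m ≠ 0) {S : Set ℝ}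
    (hS : S ⊆ resonantSet σ R ξ m)
    (hsign : ∀ w ∈ S, ∀ w' ∈ S, 0 < (ξ - m / w) * (ξ - m / w')) :
    S.InjOn (resonanceAt σ ξ m) := by
  intro w hw w' hw' heq
  by_contra hne
  have hw0 := (hS hw).1
  have hw0' := (hS hw').1
  have hprod : w * w' = 2 * σ * m := by
    have heq := mul_left_cancel₀ (div_ne_zero hm hξ) heq
    field_simp at heq
    have hfactor : ξ * (w - w') * (w * w' - 2 * σ * m) = 0 := by linear_combination heq
    exact sub_eq_zero.1
      ((mul_eq_zero.1 hfactor).resolve_left (mul_ne_zero hξ (sub_ne_zero.2 hne)))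
  have hpos := mul_pos_of_mem_resonantSet hσ hR (hS hw)
  have hpos' := mul_pos_of_mem_resonantSet hσ hR (hS hw')
  rw [← mul_div_assoc, ← hprod, mul_div_cancel_left₀ _ hw0] at hpos
  rw [← mul_div_assoc, ← hprod, mul_div_cancel_right₀ _ hw0'] at hpos'
  nlinarith [mul_pos hpos hpos', mul_nonneg (sq_nonneg ((w - w') * σ)) (hsign w hw w' hw').le]

theorem setLIntegral_resonanceAt_le_of_sign (hσ : σ ^ 2 = 3) (hR : 0 < R) (hRξ : R ≤ |ξ|)
    (hm : m ≠ 0) {S : Set ℝ} (hSm : MeasurableSet S) (hS : S ⊆ resonantSet σ R ξ m)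
    (hsign : ∀ w ∈ S, ∀ w' ∈ S, 0 < (ξ - m / w) * (ξ - m / w')) (g : ℝ → ℝ≥0∞) :
    ∫⁻ w in S, ENNReal.ofReal (|w⁻¹| * (|m / w| * |ξ - m / w|)) * g (resonanceAt σ ξ m w) ≤
      ENNReal.ofReal |ξ|⁻¹ * ∫⁻ t, g t := by
  have hξ : 0 < |ξ| := hR.trans_le hRξ
  refine setLIntegral_mul_comp_le_of_injOn hSm
    (fun w hw => hasDerivAt_resonanceAt (abs_pos.1 hξ) (hS hw).1)
    (injOn_resonanceAt hσ hR (abs_pos.1 hξ) hm hS hsign) (by positivity) (fun w hw => ?_) g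
  rw [abs_mul, abs_inv]
  gcongr ?_⁻¹ * (_ * ?_)
  · exact abs_le_abs_of_mem_resonantSet hσ hRξ (hS hw)
  · exact abs_sub_le_abs_of_mem_resonantSet hσ (hS hw)

theorem setLIntegral_resonanceAt_le (hσ : σ ^ 2 = 3) (hR : 0 < R) (hRξ : R ≤ |ξ|) (hm : m ≠ 0)
    (g : ℝ → ℝ≥0∞) :
    ∫⁻ w in resonantSet σ R ξ m,
        ENNReal.ofReal (|w⁻¹| * (|m / w| * |ξ - m / w|)) * g (resonanceAt σ ξ m w) ≤
      2 * ENNReal.ofReal |ξ|⁻¹ * ∫⁻ t, g t := by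
  have hmeas := measurableSet_resonantSet σ R ξ m
  set P : Set ℝ := {w | 0 < ξ - m / w}
  have hPm : MeasurableSet P := measurableSet_lt measurable_const (by fun_prop)
  have hneg (w : ℝ) (hw : w ∈ resonantSet σ R ξ m \ P) : ξ - m / w < 0 :=
    lt_of_le_of_ne (not_lt.1 hw.2) (abs_pos.1 (hR.trans_le hw.1.2.2))
  rw [← lintegral_inter_add_sdiff _ _ hPm, two_mul, add_mul]
  exact add_le_add
    (setLIntegral_resonanceAt_le_of_sign hσ hR hRξ hm (hmeas.inter hPm) Set.inter_subset_left
      (fun w hw w' hw' => mul_pos hw.2 hw'.2) g)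
    (setLIntegral_resonanceAt_le_of_sign hσ hR hRξ hm (hmeas.diff hPm) Set.sdiff_subset
      (fun w hw w' hw' => mul_pos_of_neg_of_neg (hneg w hw) (hneg w' hw')) g)

end Resonance

theorem lintegral_lintegral_lintegral_rotate {α β γ : Type*} [MeasurableSpace α]
    [MeasurableSpace β] [MeasurableSpace γ] {μ : Measure α} {ν : Measure β} {ρ : Measure γ}
    [SFinite μ] [SFinite ν] [SFinite ρ] {f : α → β → γ → ℝ≥0∞}
    (hf : Measurable fun p : α × β × γ => f p.1 p.2.1 p.2.2) :
    ∫⁻ x, ∫⁻ y, ∫⁻ z, f x y z ∂ρ ∂ν ∂μ = ∫⁻ y, ∫⁻ z, ∫⁻ x, f x y z ∂μ ∂ρ ∂ν := by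
  have hf' : Measurable fun p : (α × β) × γ => f p.1.1 p.1.2 p.2 :=
    hf.comp (by fun_prop : Measurable fun p : (α × β) × γ => (p.1.1, p.1.2, p.2))
  rw [lintegral_lintegral_swap hf'.lintegral_prod_right'.aemeasurable]
  refine lintegral_congr fun y => lintegral_lintegral_swap ?_
  exact (hf.comp (by fun_prop : Measurable fun p : α × γ => (p.1, y, p.2))).aemeasurable

theorem lintegral_lintegral_eq_hyperbolic {f : ℝ → ℝ → ℝ≥0∞}
    (hf : Measurable fun p : ℝ × ℝ => f p.1 p.2) (c : ℝ) :
    ∫⁻ y, ∫⁻ z, f y z = ∫⁻ m, ∫⁻ w, ENNReal.ofReal |w⁻¹| * f (c - w) (m / w) := by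
  have hcomp : Measurable fun p : ℝ × ℝ => f (c - p.1) (p.2 / p.1) :=
    hf.comp (by fun_prop : Measurable fun p : ℝ × ℝ => (c - p.1, p.2 / p.1))
  calc ∫⁻ y, ∫⁻ z, f y z = ∫⁻ w, ∫⁻ z, f (c - w) z :=
        (lintegral_sub_left_eq_self (fun y => ∫⁻ z, f y z) c).symm
    _ = ∫⁻ w, ∫⁻ m, ENNReal.ofReal |w⁻¹| * f (c - w) (m / w) := by
        refine lintegral_congr_ae ((Measure.ae_ne volume 0).mono fun w hw => ?_)
        beta_reduce
        rw [lintegral_eq_lintegral_affine (inv_ne_zero hw) 0]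
        simp only [add_zero, div_eq_inv_mul]
    _ = _ := lintegral_lintegral_swap
        ((by fun_prop : Measurable fun p : ℝ × ℝ => ENNReal.ofReal |p.1⁻¹|).mul hcomp).aemeasurable

/-- The measure `|ξ| dξ`, the Jacobian factor of `kpChart`. -/
noncomputable def absVolume : Measure ℝ := volume.withDensity fun ξ => ENNReal.ofReal |ξ|

instance : SFinite absVolume := inferInstanceAs (SFinite (volume.withDensity _))

theorem lintegral_absVolume (g : ℝ → ℝ≥0∞) :
    ∫⁻ ξ, g ξ ∂absVolume = ∫⁻ ξ, ENNReal.ofReal |ξ| * g ξ :=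
  lintegral_withDensity_eq_lintegral_mul_non_measurable _ (by fun_prop)
    (Filter.Eventually.of_forall fun _ => ENNReal.ofReal_lt_top) g

theorem ae_absVolume_ne_zero : ∀ᵐ ξ ∂absVolume, ξ ≠ 0 :=
  (withDensity_absolutelyContinuous _ _).ae_le (Measure.ae_ne volume 0)

/-- The point of frequency `ξ` and modulation `x.1` with `μ = σ ξ² + x.2 ξ`. The coordinate `x.2`
is the slope `kpSlope σ`; for `σ² = 3` both `μ` and `ω(ξ, μ)` are adapted to the factorization of
the resonance function. -/
noncomputable def kpChart (σ : ℝ) (x : ℝ × ℝ) (ξ : ℝ) : ℝ × ℝ × ℝ :=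
  (ξ, σ * ξ ^ 2 + x.2 * ξ, kpOmega ξ (σ * ξ ^ 2 + x.2 * ξ) + x.1)

/-- The number `μ / ξ - σ ξ`, the second coordinate of `kpChart σ`. -/
noncomputable def kpSlope (σ : ℝ) (a : ℝ × ℝ × ℝ) : ℝ := a.2.1 / a.1 - σ * a.1

theorem kpModulation_kpChart (σ : ℝ) (x : ℝ × ℝ) (ξ : ℝ) :
    kpModulation (kpChart σ x ξ) = x.1 :=
  add_sub_cancel_left _ _

theorem kpSlope_kpChart (σ : ℝ) (x : ℝ × ℝ) {ξ : ℝ} (hξ : ξ ≠ 0) :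
    kpSlope σ (kpChart σ x ξ) = x.2 := by
  unfold kpSlope kpChart
  field_simp
  ring

@[fun_prop]
theorem measurable_kpSlope (σ : ℝ) : Measurable (kpSlope σ) := by
  unfold kpSlope
  fun_prop

@[fun_prop]
theorem measurable_kpChart {α : Type*} [MeasurableSpace α] (σ : ℝ) {x : α → ℝ × ℝ} {ξ : α → ℝ}
    (hx : Measurable x) (hξ : Measurable ξ) : Measurable fun a => kpChart σ (x a) (ξ a) := by
  unfold kpChart kpOmega
  fun_prop

section Chart

variable {F : ℝ × ℝ × ℝ → ℝ≥0∞}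

theorem lintegral_eq_lintegral_lintegral_lintegral (hF : Measurable F) :
    ∫⁻ a, F a = ∫⁻ ξ, ∫⁻ μ, ∫⁻ τ, F (ξ, μ, τ) := by
  rw [Measure.volume_eq_prod, lintegral_prod _ hF.aemeasurable]
  refine lintegral_congr fun ξ => ?_
  rw [Measure.volume_eq_prod, lintegral_prod _ (by fun_prop)]

theorem lintegral_kpChart (σ : ℝ) (hF : Measurable F) :
    ∫⁻ a, F a = ∫⁻ x : ℝ × ℝ, ∫⁻ ξ, F (kpChart σ x ξ) ∂absVolume := by
  calc ∫⁻ a, F a = ∫⁻ ξ, ∫⁻ μ, ∫⁻ τ, F (ξ, μ, τ) :=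
        lintegral_eq_lintegral_lintegral_lintegral hF
    _ = ∫⁻ ξ, ENNReal.ofReal |ξ| * ∫⁻ β, ∫⁻ θ, F (kpChart σ (θ, β) ξ) := by
        refine lintegral_congr_ae ((Measure.ae_ne volume 0).mono fun ξ hξ => ?_)
        beta_reduce
        rw [lintegral_eq_lintegral_affine hξ (σ * ξ ^ 2),
          lintegral_const_mul' _ _ ENNReal.ofReal_ne_top]
        refine congrArg _ (lintegral_congr fun β => ?_)
        rw [← lintegral_add_left_eq_self _ (kpOmega ξ (ξ * β + σ * ξ ^ 2))]
        simp only [kpChart, add_comm (σ * ξ ^ 2), mul_comm β]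
    _ = ∫⁻ ξ, (∫⁻ β, ∫⁻ θ, F (kpChart σ (θ, β) ξ)) ∂absVolume := (lintegral_absVolume _).symm
    _ = ∫⁻ θ, ∫⁻ β, (∫⁻ ξ, F (kpChart σ (θ, β) ξ) ∂absVolume) := by
        rw [lintegral_lintegral_lintegral_rotate (by fun_prop),
          lintegral_lintegral_swap (by fun_prop)]
    _ = _ := by
        rw [Measure.volume_eq_prod, lintegral_prod _ (by fun_prop)]

theorem setLIntegral_kpChart (σ : ℝ) (hF : Measurable F) {A B : Set ℝ} (hA : MeasurableSet A)
    (hB : MeasurableSet B) :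
    ∫⁻ a in {a | kpModulation a ∈ A ∧ kpSlope σ a ∈ B}, F a =
      ∫⁻ θ in A, ∫⁻ β in B, ∫⁻ ξ, F (kpChart σ (θ, β) ξ) ∂absVolume := by
  have hS : MeasurableSet {a | kpModulation a ∈ A ∧ kpSlope σ a ∈ B} :=
    (measurable_kpModulation hA).inter (measurable_kpSlope σ hB)
  rw [← lintegral_indicator hS, lintegral_kpChart σ (hF.indicator hS), Measure.volume_eq_prod,
    ← lintegral_prod (f := fun x : ℝ × ℝ => ∫⁻ ξ, F (kpChart σ x ξ) ∂absVolume)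
      (by fun_prop), Measure.prod_restrict, ← lintegral_indicator (hA.prod hB)]
  refine lintegral_congr fun x => ?_
  by_cases hx : x ∈ A ×ˢ B
  · rw [Set.indicator_of_mem hx]
    refine lintegral_congr_ae (ae_absVolume_ne_zero.mono fun ξ hξ => ?_)
    refine Set.indicator_of_mem ?_ _
    rwa [Set.mem_ofPred_eq, kpModulation_kpChart, kpSlope_kpChart σ x hξ]
  · rw [Set.indicator_of_notMem hx]
    refine lintegral_eq_zero_of_ae_eq_zero (ae_absVolume_ne_zero.mono fun ξ hξ => ?_)
    refine Set.indicator_of_notMem ?_ _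
    rwa [Set.mem_ofPred_eq, kpModulation_kpChart, kpSlope_kpChart σ x hξ]

end Chart

section ResonantInteraction

variable {σ R κ : ℝ} {E : ℝ × ℝ × ℝ → ℝ≥0∞}

theorem kpChart_add_kpChart (hσ : σ ^ 2 = 3) (x : ℝ × ℝ) (θ m : ℝ) {ξ w : ℝ} (hξ : ξ ≠ 0)
    (hw : w ≠ 0) :
    kpChart σ x (ξ - m / w) + kpChart (-σ) (θ, 2 * σ * ξ + x.2 - w) (m / w) =
      (ξ, σ * ξ ^ 2 + x.2 * ξ - m,
        kpOmega ξ (σ * ξ ^ 2 + x.2 * ξ - m) + (x.1 + θ) + resonanceAt σ ξ m w) := by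
  obtain ⟨z, rfl⟩ : ∃ z, m = z * w := ⟨m / w, (div_mul_cancel₀ m hw).symm⟩
  obtain ⟨t, rfl⟩ : ∃ t, ξ = t + z := ⟨ξ - z, (sub_add_cancel ξ z).symm⟩
  simp only [kpChart, kpOmega, resonanceAt, mul_div_cancel_right₀ z hw, add_sub_cancel_right,
    Prod.mk_add_mk, Prod.mk.injEq]
  refine ⟨trivial, by ring, ?_⟩
  field_simp
  linear_combination (t * z * (t + z) ^ 2) * hσ

theorem setLIntegral_kpChart_add_kpChart_le (hσ : σ ^ 2 = 3) (hR : 0 < R) (x : ℝ × ℝ) (θ m : ℝ)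
    {ξ : ℝ} (hRξ : R ≤ |ξ|) :
    ∫⁻ w in resonantSet σ R ξ m, ENNReal.ofReal (|w⁻¹| * (|m / w| * |ξ - m / w|)) *
        E (kpChart σ x (ξ - m / w) + kpChart (-σ) (θ, 2 * σ * ξ + x.2 - w) (m / w)) ≤
      2 * ENNReal.ofReal |ξ|⁻¹ * ∫⁻ τ, E (ξ, σ * ξ ^ 2 + x.2 * ξ - m, τ) := by
  obtain rfl | hm := eq_or_ne m 0
  · simp
  set μ := σ * ξ ^ 2 + x.2 * ξ - m
  have hξ : ξ ≠ 0 := abs_pos.1 (hR.trans_le hRξ)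
  calc _ = ∫⁻ w in resonantSet σ R ξ m, ENNReal.ofReal (|w⁻¹| * (|m / w| * |ξ - m / w|)) *
          E (ξ, μ, kpOmega ξ μ + (x.1 + θ) + resonanceAt σ ξ m w) :=
        setLIntegral_congr_fun (measurableSet_resonantSet σ R ξ m) fun w hw => by
          rw [kpChart_add_kpChart hσ x θ m hξ hw.1]
    _ ≤ 2 * ENNReal.ofReal |ξ|⁻¹ * ∫⁻ t, E (ξ, μ, kpOmega ξ μ + (x.1 + θ) + t) :=
        setLIntegral_resonanceAt_le hσ hR hRξ hm fun t => E (ξ, μ, kpOmega ξ μ + (x.1 + θ) + t)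
    _ = _ := by rw [lintegral_add_left_eq_self fun t => E (ξ, μ, t)]

theorem lintegral_eq_lintegral_hyperbolic_shear {f : ℝ → ℝ → ℝ → ℝ≥0∞}
    (hf : Measurable fun p : ℝ × ℝ × ℝ => f p.1 p.2.1 p.2.2) (c : ℝ → ℝ) :
    ∫⁻ y, ∫⁻ z, ∫⁻ t, f t y z =
      ∫⁻ ξ, ∫⁻ m, ∫⁻ w, ENNReal.ofReal |w⁻¹| * f (ξ - m / w) (c ξ - w) (m / w) := by
  have hshear : Measurable fun p : ℝ × ℝ × ℝ => f (p.1 - p.2.2) p.2.1 p.2.2 :=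
    hf.comp (by fun_prop : Measurable fun p : ℝ × ℝ × ℝ => (p.1 - p.2.2, p.2.1, p.2.2))
  calc ∫⁻ y, ∫⁻ z, ∫⁻ t, f t y z = ∫⁻ y, ∫⁻ z, ∫⁻ ξ, f (ξ - z) y z :=
        lintegral_congr fun y => lintegral_congr fun z =>
          (lintegral_sub_right_eq_self (fun t => f t y z) z).symm
    _ = ∫⁻ ξ, ∫⁻ y, ∫⁻ z, f (ξ - z) y z := (lintegral_lintegral_lintegral_rotate hshear).symm
    _ = _ := lintegral_congr fun ξ => lintegral_lintegral_eq_hyperbolic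
        (hshear.comp (by fun_prop : Measurable fun p : ℝ × ℝ => (ξ, p.1, p.2))) (c ξ)

/-- The integrand, with respect to Lebesgue measure in `(ξ₁, y, ξ₂)`, of the resonant interaction
between a point `kpChart σ x ξ₁` with `R ≤ |ξ₁|` and a point `kpChart (-σ) (θ, y) ξ₂` whose slope
`y` is within `R` of the slope `x.2` of the first one. -/
noncomputable def resonantIntegrand (σ R : ℝ) (E : ℝ × ℝ × ℝ → ℝ≥0∞) (x : ℝ × ℝ) (θ : ℝ) :
    ℝ × ℝ × ℝ → ℝ≥0∞ :=
  {p | p.2.1 ∈ Metric.closedBall x.2 R ∧ R ≤ |p.1|}.indicator fun p =>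
    ENNReal.ofReal (|p.2.2| * |p.1|) * E (kpChart σ x p.1 + kpChart (-σ) (θ, p.2.1) p.2.2)

theorem measurable_resonantIntegrand (hE : Measurable E) (x : ℝ × ℝ) (θ : ℝ) :
    Measurable (resonantIntegrand σ R E x θ) :=
  Measurable.indicator (by fun_prop) <|
    ((by fun_prop : Measurable fun p : ℝ × ℝ × ℝ => p.2.1)
      Metric.isClosed_closedBall.measurableSet).inter <|
      measurableSet_le measurable_const (by fun_prop : Measurable fun p : ℝ × ℝ × ℝ => |p.1|)

theorem lintegral_kpChart_add_kpChart_eq (x : ℝ × ℝ) (θ : ℝ) :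
    ∫⁻ y in Metric.closedBall x.2 R, ∫⁻ z, (∫⁻ t in {t | R ≤ |t|},
        E (kpChart σ x t + kpChart (-σ) (θ, y) z) ∂absVolume) ∂absVolume =
      ∫⁻ y, ∫⁻ z, ∫⁻ t, resonantIntegrand σ R E x θ (t, y, z) := by
  have hm : MeasurableSet {t : ℝ | R ≤ |t|} :=
    measurableSet_le measurable_const (by fun_prop : Measurable fun t : ℝ => |t|)
  rw [← lintegral_indicator Metric.isClosed_closedBall.measurableSet]
  refine lintegral_congr fun y => ?_
  by_cases hy : y ∈ Metric.closedBall x.2 R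
  · rw [Set.indicator_of_mem hy, lintegral_absVolume]
    refine lintegral_congr fun z => ?_
    rw [← lintegral_indicator hm, lintegral_absVolume,
      ← lintegral_const_mul' _ _ ENNReal.ofReal_ne_top]
    refine lintegral_congr fun t => ?_
    by_cases ht : R ≤ |t|
    · simp [resonantIntegrand, Metric.mem_closedBall.1 hy, ht, mul_assoc]
    · simp [resonantIntegrand, ht]
  · simp [resonantIntegrand, -Metric.mem_closedBall, hy]

theorem lintegral_resonantIntegrand_le (hσ : σ ^ 2 = 3) (hR : 0 < R) (hRκ : R ≤ κ)
    (hE : E.support ⊆ {a | κ ≤ |a.1|}) (x : ℝ × ℝ) (θ ξ m : ℝ) :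
    ∫⁻ w, ENNReal.ofReal |w⁻¹| *
        resonantIntegrand σ R E x θ (ξ - m / w, 2 * σ * ξ + x.2 - w, m / w) ≤
      2 * ENNReal.ofReal κ⁻¹ * ∫⁻ τ, E (ξ, σ * ξ ^ 2 + x.2 * ξ - m, τ) := by
  by_cases hξ : κ ≤ |ξ|
  · have hκ : 0 < κ := hR.trans_le hRκ
    grw [hξ, ← setLIntegral_kpChart_add_kpChart_le hσ hR x θ m (hRκ.trans hξ),
      ← lintegral_indicator (measurableSet_resonantSet σ R ξ m)]
    refine lintegral_mono_ae ((Measure.ae_ne volume 0).mono fun w hw => ?_)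
    have hdist : dist (2 * σ * ξ + x.2 - w) x.2 = |w - 2 * σ * ξ| := by
      rw [Real.dist_eq, abs_sub_comm]
      congr 1
      ring
    refine le_of_eq ?_
    simp only [resonantIntegrand, resonantSet, Set.indicator_apply, Set.mem_ofPred_eq,
      Metric.mem_closedBall, hdist, ne_eq, hw, not_false_eq_true, true_and, mul_ite, mul_zero,
      abs_nonneg, ← ENNReal.ofReal_mul, ← mul_assoc]
  · have hE₀ (w : ℝ) : E (kpChart σ x (ξ - m / w) +
        kpChart (-σ) (θ, 2 * σ * ξ + x.2 - w) (m / w)) = 0 := by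
      refine Function.notMem_support.1 fun h => hξ ?_
      simpa [kpChart] using hE h
    simp [resonantIntegrand, Set.indicator_apply, hE₀]

theorem lintegral_kpChart_add_kpChart_le (hσ : σ ^ 2 = 3) (hR : 0 < R) (hRκ : R ≤ κ)
    (hE : Measurable E) (hEs : E.support ⊆ {a | κ ≤ |a.1|}) (x : ℝ × ℝ) (θ : ℝ) :
    ∫⁻ y in Metric.closedBall x.2 R, ∫⁻ z, (∫⁻ t in {t | R ≤ |t|},
        E (kpChart σ x t + kpChart (-σ) (θ, y) z) ∂absVolume) ∂absVolume ≤
      2 * ENNReal.ofReal κ⁻¹ * ∫⁻ a, E a := by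
  calc _ = ∫⁻ y, ∫⁻ z, ∫⁻ t, resonantIntegrand σ R E x θ (t, y, z) :=
        lintegral_kpChart_add_kpChart_eq x θ
    _ = ∫⁻ ξ, ∫⁻ m, ∫⁻ w, ENNReal.ofReal |w⁻¹| *
          resonantIntegrand σ R E x θ (ξ - m / w, 2 * σ * ξ + x.2 - w, m / w) :=
        lintegral_eq_lintegral_hyperbolic_shear
          (f := fun t y z => resonantIntegrand σ R E x θ (t, y, z))
          (measurable_resonantIntegrand hE x θ) _
    _ ≤ ∫⁻ ξ, ∫⁻ m, 2 * ENNReal.ofReal κ⁻¹ * ∫⁻ τ, E (ξ, σ * ξ ^ 2 + x.2 * ξ - m, τ) := by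
        gcongr with ξ m
        exact lintegral_resonantIntegrand_le hσ hR hRκ hEs x θ ξ m
    _ = _ := by
        have hfin : 2 * ENNReal.ofReal κ⁻¹ ≠ ∞ :=
          ENNReal.mul_ne_top ENNReal.ofNat_ne_top ENNReal.ofReal_ne_top
        simp only [lintegral_const_mul' _ _ hfin]
        rw [lintegral_eq_lintegral_lintegral_lintegral hE]
        congr! 3 with ξ
        exact lintegral_sub_left_eq_self (fun μ => ∫⁻ τ, E (ξ, μ, τ)) _

end ResonantInteraction

section Sections

variable {X Y Z : Type*} [MeasurableSpace X] [MeasurableSpace Y] [MeasurableSpace Z]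
  {μ : Measure X} {ν : Measure Y} {ρ : Measure Z} [SFinite ρ]

theorem sq_lintegral_lintegral_mul_mul_le [SFinite ν] {f : Y → ℝ≥0∞} (hf : Measurable f)
    {g : Z → ℝ≥0∞} (hg : Measurable g) {h : Y → Z → ℝ≥0∞} (hh : Measurable h.uncurry) :
    (∫⁻ y, ∫⁻ z, f y * g z * h y z ∂ρ ∂ν) ^ 2 ≤
      (∫⁻ y, f y ^ 2 ∂ν) * (∫⁻ z, g z ^ 2 ∂ρ) * ∫⁻ z, ∫⁻ y, h y z ^ 2 ∂ν ∂ρ := by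
  have hprod := sq_lintegral_mul_le (μ := ν.prod ρ) (f := fun p => f p.1 * g p.2)
    (g := h.uncurry) (by fun_prop) (by fun_prop)
  simp only [mul_pow] at hprod
  rwa [lintegral_prod _ (by fun_prop),
    lintegral_prod_mul (hf.pow_const 2).aemeasurable (hg.pow_const 2).aemeasurable,
    lintegral_prod_symm _ (by fun_prop)] at hprod

variable {W : Set (X × Z)}

theorem measurable_setLIntegral_prodMk (hW : MeasurableSet W) {g : X → Z → ℝ≥0∞}
    (hg : Measurable g.uncurry) : Measurable fun x => ∫⁻ z in Prod.mk x ⁻¹' W, g x z ∂ρ := by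
  simp only [← lintegral_indicator (measurable_prodMk_left hW)]
  exact (hg.indicator hW).lintegral_prod_right'

variable [SFinite μ]

theorem lintegral_setLIntegral_prodMk (hW : MeasurableSet W) {g : Z → ℝ≥0∞}
    (hg : Measurable g) :
    ∫⁻ x, (∫⁻ z in Prod.mk x ⁻¹' W, g z ∂ρ) ∂μ = ∫⁻ z, g z * μ {x | (x, z) ∈ W} ∂ρ := by
  calc _ = ∫⁻ x, ∫⁻ z, W.indicator (fun p => g p.2) (x, z) ∂ρ ∂μ :=
        lintegral_congr fun x => (lintegral_indicator (measurable_prodMk_left hW) g).symm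
    _ = ∫⁻ z, ∫⁻ x, W.indicator (fun p => g p.2) (x, z) ∂μ ∂ρ :=
        lintegral_lintegral_swap (((by fun_prop : Measurable fun p : X × Z => g p.2).indicator
          hW).aemeasurable)
    _ = _ := lintegral_congr fun z => lintegral_indicator_const (measurable_prodMk_right hW) (g z)

/-- Two applications of Cauchy–Schwarz, first in `(y, z)` at fixed `x` and then in `x`. -/
theorem sq_lintegral_lintegral_setLIntegral_le [SFinite ν] (hW : MeasurableSet W)
    {f : X → Y → ℝ≥0∞} (hf : Measurable f.uncurry) {g : Z → ℝ≥0∞} (hg : Measurable g)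
    {h : X → Y → Z → ℝ≥0∞} (hh : ∀ x, Measurable (h x).uncurry) {M Q : ℝ≥0∞}
    (hM : ∀ z, μ {x | (x, z) ∈ W} ≤ M)
    (hQ : ∀ x, ∫⁻ z in Prod.mk x ⁻¹' W, (∫⁻ y, h x y z ^ 2 ∂ν) ∂ρ ≤ Q) :
    (∫⁻ x, ∫⁻ y, (∫⁻ z in Prod.mk x ⁻¹' W, f x y * g z * h x y z ∂ρ) ∂ν ∂μ) ^ 2 ≤
      Q * M * (∫⁻ x, ∫⁻ y, f x y ^ 2 ∂ν ∂μ) * ∫⁻ z, g z ^ 2 ∂ρ := by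
  have hsq (x : X) : (∫⁻ y, (∫⁻ z in Prod.mk x ⁻¹' W, f x y * g z * h x y z ∂ρ) ∂ν) ^ 2 ≤
      (∫⁻ y, f x y ^ 2 ∂ν) * (∫⁻ z in Prod.mk x ⁻¹' W, g z ^ 2 ∂ρ) * Q := by
    grw [← hQ x]
    exact sq_lintegral_lintegral_mul_mul_le (hf.comp measurable_prodMk_left) hg (hh x)
  have hgW : Measurable fun x => ∫⁻ z in Prod.mk x ⁻¹' W, g z ^ 2 ∂ρ :=
    measurable_setLIntegral_prodMk hW (by fun_prop)
  calc _ ≤ (∫⁻ x, ∫⁻ y, f x y ^ 2 ∂ν ∂μ) * ∫⁻ x, (∫⁻ z in Prod.mk x ⁻¹' W, g z ^ 2 ∂ρ) * Q ∂μ :=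
        sq_lintegral_le_of_forall_sq_le_mul (by fun_prop) (hgW.mul_const Q).aemeasurable
          fun x => (hsq x).trans_eq (mul_assoc _ _ _)
    _ = (∫⁻ x, ∫⁻ y, f x y ^ 2 ∂ν ∂μ) * ((∫⁻ z, g z ^ 2 * μ {x | (x, z) ∈ W} ∂ρ) * Q) := by
        rw [lintegral_mul_const _ hgW, lintegral_setLIntegral_prodMk hW (by fun_prop)]
    _ ≤ (∫⁻ x, ∫⁻ y, f x y ^ 2 ∂ν ∂μ) * ((∫⁻ z, g z ^ 2 * M ∂ρ) * Q) := by
        gcongr with z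
        exact hM z
    _ = _ := by
        rw [lintegral_mul_const _ (by fun_prop)]
        ring

end Sections

theorem setLIntegral_lintegral_kpChart_add_le {σ R κ J : ℝ} {E : ℝ × ℝ × ℝ → ℝ≥0∞}
    (hσ : σ ^ 2 = 3) (hR : 0 < R) (hRκ : R ≤ κ) (hE : Measurable E)
    (hEs : E.support ⊆ {a | κ ≤ |a.1|}) (x : ℝ × ℝ) :
    ∫⁻ b in {b | kpModulation b ∈ Metric.closedBall 0 J ∧
        kpSlope (-σ) b ∈ Metric.closedBall x.2 R}, (∫⁻ t in {t | R ≤ |t|},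
          E (kpChart σ x t + b) ∂absVolume) ≤
      ENNReal.ofReal (2 * J) * (2 * ENNReal.ofReal κ⁻¹ * ∫⁻ a, E a) := by
  have hball (c r : ℝ) : MeasurableSet (Metric.closedBall c r) :=
    Metric.isClosed_closedBall.measurableSet
  rw [setLIntegral_kpChart (-σ) (by fun_prop) (hball 0 J) (hball x.2 R)]
  grw [setLIntegral_mono' (hball 0 J) fun θ _ =>
    lintegral_kpChart_add_kpChart_le hσ hR hRκ hE hEs x θ]
  rw [setLIntegral_const, Real.volume_closedBall, mul_comm]

/-- The pairs consisting of chart coordinates `x` and a point `b` which can interact resonantly. -/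
def resonantPairs (σ R J₁ J₂ : ℝ) : Set ((ℝ × ℝ) × (ℝ × ℝ × ℝ)) :=
  {p | p.1.1 ∈ Metric.closedBall 0 J₁ ∧ kpModulation p.2 ∈ Metric.closedBall 0 J₂ ∧
    kpSlope (-σ) p.2 ∈ Metric.closedBall p.1.2 R}

theorem measurableSet_resonantPairs (σ R J₁ J₂ : ℝ) :
    MeasurableSet (resonantPairs σ R J₁ J₂) := by
  refine .inter (.preimage Metric.isClosed_closedBall.measurableSet (by fun_prop)) <|
    .inter (.preimage Metric.isClosed_closedBall.measurableSet (by fun_prop)) ?_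
  exact measurableSet_le (by fun_prop :
    Measurable fun p : (ℝ × ℝ) × (ℝ × ℝ × ℝ) => dist (kpSlope (-σ) p.2) p.1.2) measurable_const

theorem volume_resonantPairs_le (σ R J₁ J₂ : ℝ) (b : ℝ × ℝ × ℝ) :
    volume {x : ℝ × ℝ | (x, b) ∈ resonantPairs σ R J₁ J₂} ≤
      ENNReal.ofReal (2 * J₁) * ENNReal.ofReal (2 * R) := by
  calc _ ≤ volume (Metric.closedBall (0 : ℝ) J₁ ×ˢ Metric.closedBall (kpSlope (-σ) b) R) := by
        refine measure_mono fun x hx => ⟨hx.1, Metric.mem_closedBall_comm.1 hx.2.2⟩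
    _ = _ := by
        rw [Measure.volume_eq_prod, Measure.prod_prod, Real.volume_closedBall,
          Real.volume_closedBall]

section Resonant

variable {σ R κ J₁ J₂ : ℝ} {F₁ F₂ F₃ : ℝ × ℝ × ℝ → ℝ≥0∞}

theorem lintegral_setLIntegral_resonant_le (h₁ : Measurable F₁) (h₂ : Measurable F₂)
    (h₃ : Measurable F₃) (s₁ : F₁.support ⊆ {a | R ≤ |a.1| ∧ |kpModulation a| ≤ J₁})
    (s₂ : F₂.support ⊆ {b | |kpModulation b| ≤ J₂}) :
    ∫⁻ a, (∫⁻ b in {b | |kpSlope (-σ) b - kpSlope σ a| ≤ R}, F₁ a * F₂ b * F₃ (-(a + b))) ≤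
      ∫⁻ x, ∫⁻ t in {t | R ≤ |t|}, (∫⁻ b in Prod.mk x ⁻¹' resonantPairs σ R J₁ J₂,
        F₁ (kpChart σ x t) * F₂ b * F₃ (-(kpChart σ x t + b))) ∂absVolume := by
  have hW : MeasurableSet {p : (ℝ × ℝ × ℝ) × ℝ × ℝ × ℝ |
      |kpSlope (-σ) p.2 - kpSlope σ p.1| ≤ R} := measurableSet_le (by fun_prop :
    Measurable fun p : (ℝ × ℝ × ℝ) × ℝ × ℝ × ℝ => |kpSlope (-σ) p.2 - kpSlope σ p.1|)
    measurable_const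
  have hT : MeasurableSet {t : ℝ | R ≤ |t|} :=
    measurableSet_le measurable_const (by fun_prop : Measurable fun t : ℝ => |t|)
  refine (lintegral_kpChart σ (measurable_setLIntegral_prodMk hW
    (g := fun a b => F₁ a * F₂ b * F₃ (-(a + b))) (by fun_prop))).trans_le ?_
  refine lintegral_mono fun x => ?_
  rw [← lintegral_indicator hT]
  refine lintegral_mono_ae (ae_absVolume_ne_zero.mono fun t ht => ?_)
  by_cases hF₁ : F₁ (kpChart σ x t) = 0
  · simp [hF₁]
  obtain ⟨htR, hxJ⟩ := s₁ hF₁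
  rw [kpModulation_kpChart] at hxJ
  rw [Set.indicator_of_mem (show t ∈ {t : ℝ | R ≤ |t|} from htR),
    ← lintegral_indicator (measurable_prodMk_left (measurableSet_resonantPairs σ R J₁ J₂)),
    ← lintegral_indicator (measurable_prodMk_left hW)]
  refine lintegral_mono fun b => ?_
  by_cases hF₂ : F₂ b = 0
  · simp [Set.indicator, hF₂]
  have hbJ : |kpModulation b| ≤ J₂ := s₂ hF₂
  refine Set.indicator_apply_le fun hb => ?_
  have hb' : |kpSlope (-σ) b - x.2| ≤ R := by rwa [← kpSlope_kpChart σ x ht]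
  rw [Set.indicator_of_mem]
  simpa [resonantPairs, Real.dist_eq] using ⟨hxJ, hbJ, hb'⟩

theorem sq_lintegral_setLIntegral_resonant_le (hσ : σ ^ 2 = 3) (hR : 0 < R) (hRκ : R ≤ κ)
    (h₁ : Measurable F₁) (h₂ : Measurable F₂) (h₃ : Measurable F₃)
    (s₁ : F₁.support ⊆ {a | R ≤ |a.1| ∧ |kpModulation a| ≤ J₁})
    (s₂ : F₂.support ⊆ {b | |kpModulation b| ≤ J₂}) (s₃ : F₃.support ⊆ {c | κ ≤ |c.1|}) :
    (∫⁻ a, (∫⁻ b in {b | |kpSlope (-σ) b - kpSlope σ a| ≤ R},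
        F₁ a * F₂ b * F₃ (-(a + b)))) ^ 2 ≤
      ENNReal.ofReal (2 * J₂) * (2 * ENNReal.ofReal κ⁻¹ * ∫⁻ c, F₃ c ^ 2) *
        (ENNReal.ofReal (2 * J₁) * ENNReal.ofReal (2 * R)) *
        (∫⁻ a, F₁ a ^ 2) * ∫⁻ b, F₂ b ^ 2 := by
  have hQ (x : ℝ × ℝ) : ∫⁻ b in Prod.mk x ⁻¹' resonantPairs σ R J₁ J₂,
      (∫⁻ t in {t | R ≤ |t|}, F₃ (-(kpChart σ x t + b)) ^ 2 ∂absVolume) ≤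
        ENNReal.ofReal (2 * J₂) * (2 * ENNReal.ofReal κ⁻¹ * ∫⁻ c, F₃ c ^ 2) := by
    rw [← lintegral_neg_eq_self fun c => F₃ c ^ 2]
    grw [← setLIntegral_lintegral_kpChart_add_le hσ hR hRκ (E := fun c => F₃ (-c) ^ 2)
      (by fun_prop) ?_ x]
    · exact lintegral_mono_set fun b hb => hb.2
    · intro c hc
      have := s₃ (a := -c) (by simpa using hc)
      simpa using this
  grw [lintegral_setLIntegral_resonant_le h₁ h₂ h₃ s₁ s₂,
    sq_lintegral_lintegral_setLIntegral_le (measurableSet_resonantPairs σ R J₁ J₂)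
      (f := fun x t => F₁ (kpChart σ x t)) (by fun_prop) h₂
      (h := fun x t b => F₃ (-(kpChart σ x t + b))) (fun x => by fun_prop)
      (volume_resonantPairs_le σ R J₁ J₂) hQ]
  rw [lintegral_kpChart σ (h₁.pow_const 2)]
  gcongr
  exact Measure.restrict_le_self

end Resonant

section Slopes

variable {σ : ℝ} {a b : ℝ × ℝ × ℝ}

theorem kpModulation_add (hσ : σ ^ 2 = 3) (ha : a.1 ≠ 0) (hb : b.1 ≠ 0) (hab : a.1 + b.1 ≠ 0) :
    kpModulation (a + b) = kpModulation a + kpModulation b + a.1 * b.1 / (a.1 + b.1) *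
      ((kpSlope (-σ) b - kpSlope σ a) * (kpSlope σ b - kpSlope (-σ) a)) := by
  have hslopes : (kpSlope (-σ) b - kpSlope σ a) * (kpSlope σ b - kpSlope (-σ) a) =
      (a.2.1 / a.1 - b.2.1 / b.1) ^ 2 - 3 * (a.1 + b.1) ^ 2 := by
    unfold kpSlope
    linear_combination (-(a.1 + b.1) ^ 2) * hσ
  rw [hslopes]
  simp only [kpModulation, kpOmega, Prod.fst_add, Prod.snd_add]
  field_simp
  ring

theorem two_mul_abs_add_le_abs_kpSlope_sub (hσ : σ ^ 2 = 3) :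
    2 * |a.1 + b.1| ≤ |kpSlope (-σ) b - kpSlope σ a| + |kpSlope σ b - kpSlope (-σ) a| := by
  calc 2 * |a.1 + b.1| ≤ 2 * |σ| * |a.1 + b.1| := by
        gcongr
        linarith [one_le_abs_of_sq_eq_three hσ]
    _ = |(kpSlope (-σ) b - kpSlope σ a) - (kpSlope σ b - kpSlope (-σ) a)| := by
        rw [← abs_two, ← abs_mul, ← abs_mul]
        unfold kpSlope
        ring_nf
    _ ≤ _ := abs_sub _ _

theorem abs_kpSlope_sub_le_or {J R : ℝ} (hσ : σ ^ 2 = 3) (ha : a.1 ≠ 0) (hb : b.1 ≠ 0)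
    (hab : a.1 + b.1 ≠ 0) (hJR : 3 * J ≤ R * (|a.1| * |b.1|)) (hJa : |kpModulation a| ≤ J)
    (hJb : |kpModulation b| ≤ J) (hJab : |kpModulation (a + b)| ≤ J) :
    |kpSlope (-σ) b - kpSlope σ a| ≤ R ∨ |kpSlope σ b - kpSlope (-σ) a| ≤ R := by
  have hsep := two_mul_abs_add_le_abs_kpSlope_sub (a := a) (b := b) hσ
  have hmod := kpModulation_add hσ ha hb hab
  set p := kpSlope (-σ) b - kpSlope σ a
  set q := kpSlope σ b - kpSlope (-σ) a
  have hres : |a.1 * b.1 / (a.1 + b.1) * (p * q)| ≤ 3 * J := by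
    rw [abs_le] at *
    constructor <;> linarith
  have hprod : |p| * |q| ≤ R * |a.1 + b.1| := by
    rw [abs_mul, abs_div, abs_mul, abs_mul, div_mul_eq_mul_div, div_le_iff₀ (by positivity)] at hres
    refine le_of_mul_le_mul_left (hres.trans ?_) (by positivity : 0 < |a.1| * |b.1|)
    grw [hJR]
    exact le_of_eq (by ring)
  have hsum : 0 < |a.1 + b.1| := by positivity
  by_contra! h
  rcases le_total |p| |q| with hpq | hqp
  · nlinarith [mul_lt_mul_of_pos_right h.1 hsum, abs_nonneg p]
  · nlinarith [mul_lt_mul_of_pos_right h.2 hsum, abs_nonneg q]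

variable {k₁ k₂ k₃ : ℤ} {j : ℕ}

theorem zpow_le_of_mem_dyadicShell {ξ ξ' : ℝ} (hξ : ξ ∈ dyadicShell k₁) (hξ' : ξ' ∈ dyadicShell k₂)
    (hsum : -(ξ + ξ') ∈ dyadicShell k₃) (hk : k₂ ≤ k₁) : (2 : ℝ) ^ k₃ ≤ 8 * 2 ^ k₁ := by
  have hpow : (2 : ℝ) ^ k₂ ≤ 2 ^ k₁ := zpow_le_zpow_right₀ one_le_two hk
  have hlower := half_le_abs_of_mem_dyadicShell hsum
  rw [abs_neg] at hlower
  linarith [abs_add_le ξ ξ', abs_le_of_mem_dyadicShell hξ, abs_le_of_mem_dyadicShell hξ']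

theorem abs_kpSlope_sub_le_or_of_mem_kpRegionTop (hσ : σ ^ 2 = 3) (ha : a ∈ kpRegionTop k₁ j)
    (hb : b ∈ kpRegionTop k₂ j) (hab : -(a + b) ∈ kpRegionTop k₃ j) :
    |kpSlope (-σ) b - kpSlope σ a| ≤ 12 * 2 ^ j / (2 ^ k₁ * 2 ^ k₂) ∨
      |kpSlope σ b - kpSlope (-σ) a| ≤ 12 * 2 ^ j / (2 ^ k₁ * 2 ^ k₂) := by
  rw [mem_kpRegionTop_iff] at ha hb hab
  rw [Prod.fst_neg, mem_dyadicShell_neg, kpModulation_neg, abs_neg] at hab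
  refine abs_kpSlope_sub_le_or hσ (abs_pos.1 (abs_pos_of_mem_dyadicShell ha.1))
    (abs_pos.1 (abs_pos_of_mem_dyadicShell hb.1)) (abs_pos.1 (abs_pos_of_mem_dyadicShell hab.1))
    ?_ ha.2 hb.2 hab.2
  calc 3 * 2 ^ j = 12 * 2 ^ j / (2 ^ k₁ * 2 ^ k₂) * ((2 : ℝ) ^ k₁ / 2 * (2 ^ k₂ / 2)) := by
        field_simp
        norm_num
    _ ≤ _ := by
        grw [half_le_abs_of_mem_dyadicShell ha.1, half_le_abs_of_mem_dyadicShell hb.1]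

end Slopes

theorem lintegral_lintegral_le_of_support_subset_union {X Z : Type*} [MeasurableSpace X]
    [MeasurableSpace Z] {μ : Measure X} {ρ : Measure Z} [SFinite ρ] {g : X → Z → ℝ≥0∞}
    (hg : Measurable g.uncurry) {U V : Set (X × Z)} (hU : MeasurableSet U)
    (hgs : g.uncurry.support ⊆ U ∪ V) :
    ∫⁻ x, ∫⁻ z, g x z ∂ρ ∂μ ≤ (∫⁻ x, (∫⁻ z in Prod.mk x ⁻¹' U, g x z ∂ρ) ∂μ) +
      ∫⁻ x, (∫⁻ z in Prod.mk x ⁻¹' V, g x z ∂ρ) ∂μ := by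
  rw [← lintegral_add_left (measurable_setLIntegral_prodMk hU hg)]
  refine lintegral_mono fun x => ?_
  have hgx : (g x).support ⊆ Prod.mk x ⁻¹' U ∪ Prod.mk x ⁻¹' V := fun z hz =>
    hgs (a := (x, z)) hz
  exact (setLIntegral_eq_of_support_subset hgx).symm.trans_le (lintegral_union_le _ _ _)

section ResonantForm

variable {F₁ F₂ F₃ : ℝ × ℝ × ℝ → ℝ≥0∞} {k₁ k₂ k₃ : ℤ} {j₁ j₂ j₃ : ℕ}

theorem sq_lintegral_setLIntegral_le_of_kpRegionTop {σ R : ℝ} (hσ : σ ^ 2 = 3) (hR : 0 < R)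
    (hR₁ : R ≤ 2 ^ k₁ / 2) (hR₃ : R ≤ 2 ^ k₃ / 2) (h₁ : Measurable F₁) (h₂ : Measurable F₂)
    (h₃ : Measurable F₃) (s₁ : F₁.support ⊆ kpRegionTop k₁ j₁)
    (s₂ : F₂.support ⊆ kpRegionTop k₂ j₂) (s₃ : F₃.support ⊆ kpRegionTop k₃ j₃) :
    (∫⁻ a, (∫⁻ b in {b | |kpSlope (-σ) b - kpSlope σ a| ≤ R},
        F₁ a * F₂ b * F₃ (-(a + b)))) ^ 2 ≤
      ENNReal.ofReal (32 * (2 ^ j₁ * 2 ^ j₂) * R / 2 ^ k₃) *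
        (∫⁻ x, F₁ x ^ 2) * (∫⁻ x, F₂ x ^ 2) * ∫⁻ x, F₃ x ^ 2 := by
  refine (sq_lintegral_setLIntegral_resonant_le (κ := 2 ^ k₃ / 2) (J₁ := 2 ^ j₁) (J₂ := 2 ^ j₂)
    hσ hR hR₃ h₁ h₂ h₃ (fun a ha => ?_) (fun b hb => (mem_kpRegionTop_iff.1 (s₂ hb)).2)
    (fun c hc => half_le_abs_of_mem_dyadicShell (mem_kpRegionTop_iff.1 (s₃ hc)).1)).trans_eq ?_
  · have ⟨hshell, hmod⟩ := mem_kpRegionTop_iff.1 (s₁ ha)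
    exact ⟨hR₁.trans (half_le_abs_of_mem_dyadicShell hshell), hmod⟩
  · have hconst : ENNReal.ofReal (32 * (2 ^ j₁ * 2 ^ j₂) * R / 2 ^ k₃) =
        ENNReal.ofReal (2 * 2 ^ j₂) * (2 * ENNReal.ofReal (2 ^ k₃ / 2)⁻¹) *
          (ENNReal.ofReal (2 * 2 ^ j₁) * ENNReal.ofReal (2 * R)) := by
      rw [← ENNReal.ofReal_ofNat 2, ← ENNReal.ofReal_mul (by positivity),
        ← ENNReal.ofReal_mul (by positivity), ← ENNReal.ofReal_mul (by positivity),
        ← ENNReal.ofReal_mul (by positivity)]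
      congr 1
      field_simp
      norm_num
    rw [hconst]
    ring

theorem trilinearForm_le_add_setLIntegral {σ : ℝ} {j : ℕ} (hσ : σ ^ 2 = 3) (h₁ : Measurable F₁)
    (h₂ : Measurable F₂) (h₃ : Measurable F₃) (s₁ : F₁.support ⊆ kpRegionTop k₁ j)
    (s₂ : F₂.support ⊆ kpRegionTop k₂ j) (s₃ : F₃.support ⊆ kpRegionTop k₃ j) :
    trilinearForm F₁ F₂ F₃ ≤
      (∫⁻ a, (∫⁻ b in {b | |kpSlope (-σ) b - kpSlope σ a| ≤ 12 * 2 ^ j / (2 ^ k₁ * 2 ^ k₂)},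
        F₁ a * F₂ b * F₃ (-(a + b)))) +
      ∫⁻ a, (∫⁻ b in {b | |kpSlope σ b - kpSlope (-σ) a| ≤ 12 * 2 ^ j / (2 ^ k₁ * 2 ^ k₂)},
        F₁ a * F₂ b * F₃ (-(a + b))) := by
  refine lintegral_lintegral_le_of_support_subset_union
    (g := fun a b => F₁ a * F₂ b * F₃ (-(a + b))) (by fun_prop)
    (V := {p | |kpSlope σ p.2 - kpSlope (-σ) p.1| ≤ 12 * 2 ^ j / (2 ^ k₁ * 2 ^ k₂)})
    (measurableSet_le (by fun_prop : Measurable fun p : (ℝ × ℝ × ℝ) × ℝ × ℝ × ℝ =>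
      |kpSlope (-σ) p.2 - kpSlope σ p.1|) measurable_const) fun ⟨a, b⟩ hab => ?_
  have hF₁₂ : F₁ a * F₂ b ≠ 0 := left_ne_zero_of_mul hab
  exact abs_kpSlope_sub_le_or_of_mem_kpRegionTop hσ (s₁ (left_ne_zero_of_mul hF₁₂))
    (s₂ (right_ne_zero_of_mul hF₁₂)) (s₃ (right_ne_zero_of_mul hab))

theorem trilinearForm_eq_zero_of_lt_zpow (s₁ : F₁.support ⊆ kpRegionTop k₁ j₁)
    (s₂ : F₂.support ⊆ kpRegionTop k₂ j₂) (s₃ : F₃.support ⊆ kpRegionTop k₃ j₃) (hk : k₂ ≤ k₁)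
    (hk₃ : (8 : ℝ) * 2 ^ k₁ < 2 ^ k₃) : trilinearForm F₁ F₂ F₃ = 0 := by
  have hzero (a b : ℝ × ℝ × ℝ) : F₁ a * F₂ b * F₃ (-(a + b)) = 0 := by
    by_contra hab
    have hF₁₂ : F₁ a * F₂ b ≠ 0 := left_ne_zero_of_mul hab
    exact hk₃.not_ge (zpow_le_of_mem_dyadicShell
      (mem_kpRegionTop_iff.1 (s₁ (left_ne_zero_of_mul hF₁₂))).1
      (mem_kpRegionTop_iff.1 (s₂ (right_ne_zero_of_mul hF₁₂))).1
      (mem_kpRegionTop_iff.1 (s₃ (right_ne_zero_of_mul hab))).1 hk)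
  simp only [trilinearForm, hzero, lintegral_zero]

theorem sq_trilinearForm_le_of_resonant_of_le (h₁ : Measurable F₁) (h₂ : Measurable F₂)
    (h₃ : Measurable F₃) (s₁ : F₁.support ⊆ kpRegionTop k₁ j₁)
    (s₂ : F₂.support ⊆ kpRegionTop k₂ j₂) (s₃ : F₃.support ⊆ kpRegionTop k₃ j₃) (hj₁ : j₁ ≤ j₃)
    (hj₂ : j₂ ≤ j₃) (hk : k₂ ≤ k₁) (hres : (2 : ℝ) ^ 10 * 2 ^ j₃ ≤ 2 ^ (k₁ + k₂ + k₃)) :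
    trilinearForm F₁ F₂ F₃ ^ 2 ≤
      ENNReal.ofReal (1536 * (2 ^ j₁ * 2 ^ j₂ * 2 ^ j₃) / 2 ^ (k₁ + k₂ + k₃)) *
        (∫⁻ x, F₁ x ^ 2) * (∫⁻ x, F₂ x ^ 2) * ∫⁻ x, F₃ x ^ 2 := by
  rcases lt_or_ge ((8 : ℝ) * 2 ^ k₁) (2 ^ k₃) with hk₃ | hk₃
  · simp [trilinearForm_eq_zero_of_lt_zpow s₁ s₂ s₃ hk hk₃]
  rw [zpow_add₀ two_ne_zero, zpow_add₀ two_ne_zero] at hres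
  set R : ℝ := 12 * 2 ^ j₃ / (2 ^ k₁ * 2 ^ k₂) with hRdef
  have hR : 0 < R := by positivity
  have hR₃ : R ≤ 2 ^ k₃ / 64 := by
    rw [hRdef, div_le_iff₀ (by positivity)]
    linarith [(by positivity : (0 : ℝ) < 2 ^ j₃)]
  have hbound (σ : ℝ) (hσ : σ ^ 2 = 3) :=
    sq_lintegral_setLIntegral_le_of_kpRegionTop hσ hR (by linarith) (by linarith)
      h₁ h₂ h₃ s₁ s₂ s₃
  have hσ : √3 ^ 2 = (3 : ℝ) := Real.sq_sqrt (by norm_num)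
  have hneg := hbound (-√3) (by rwa [neg_sq])
  rw [neg_neg] at hneg
  grw [trilinearForm_le_add_setLIntegral hσ h₁ h₂ h₃ (s₁.trans (kpRegionTop_mono hj₁))
    (s₂.trans (kpRegionTop_mono hj₂)) s₃, ennreal_add_sq_le, hbound _ hσ, hneg]
  have hconst : ENNReal.ofReal (1536 * (2 ^ j₁ * 2 ^ j₂ * 2 ^ j₃) / 2 ^ (k₁ + k₂ + k₃)) =
      4 * ENNReal.ofReal (32 * (2 ^ j₁ * 2 ^ j₂) * R / 2 ^ k₃) := by
    rw [← ENNReal.ofReal_ofNat 4, ← ENNReal.ofReal_mul (by norm_num), zpow_add₀ two_ne_zero,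
      zpow_add₀ two_ne_zero, hRdef]
    congr 1
    field_simp
    norm_num
  rw [hconst]
  exact le_of_eq (by ring)

end ResonantForm

section Unweighted

variable {F₁ F₂ F₃ : ℝ × ℝ × ℝ → ℝ≥0∞} {k₁ k₂ k₃ : ℤ} {j₁ j₂ j₃ : ℕ}

theorem kpRegionTop_subset_abs_kpModulation_le (k : ℤ) (j : ℕ) :
    kpRegionTop k j ⊆ {x | x.1 ≠ 0 ∧ |kpModulation x| ≤ 2 ^ j} := fun _ hx =>
  have ⟨hshell, hmod⟩ := mem_kpRegionTop_iff.1 hx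
  ⟨abs_pos.1 (abs_pos_of_mem_dyadicShell hshell), hmod⟩

theorem lintegral_sq_lconvolution_le_of_kpRegionTop (h₁ : Measurable F₁) (h₂ : Measurable F₂)
    (s₁ : F₁.support ⊆ kpRegionTop k₁ j₁) (s₂ : F₂.support ⊆ kpRegionTop k₂ j₂) :
    ∫⁻ x, (F₁ ⋆ₗ F₂) x ^ 2 ≤
      ENNReal.ofReal (256 * Real.pi * 2 ^ j₁ * 2 ^ j₂) * (∫⁻ x, F₁ x ^ 2) * ∫⁻ x, F₂ x ^ 2 :=
  lintegral_sq_lconvolution_le_of_modulation h₁ h₂ (by positivity) (by positivity)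
    (s₁.trans (kpRegionTop_subset_abs_kpModulation_le k₁ j₁))
    (s₂.trans (kpRegionTop_subset_abs_kpModulation_le k₂ j₂))

theorem sq_trilinearForm_le_of_nonresonant (h₁ : Measurable F₁) (h₂ : Measurable F₂)
    (h₃ : Measurable F₃) (s₁ : F₁.support ⊆ kpRegionTop k₁ j₁)
    (s₂ : F₂.support ⊆ kpRegionTop k₂ j₂) {K : ℝ} (hK : 0 ≤ K) (hK₃ : K ≤ 2 ^ 10 * 2 ^ j₃) :
    trilinearForm F₁ F₂ F₃ ^ 2 ≤
      ENNReal.ofReal (10 ^ 6 * (2 ^ j₁ * 2 ^ j₂ * 2 ^ j₃) / (2 ^ j₃ + K)) *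
        (∫⁻ x, F₁ x ^ 2) * (∫⁻ x, F₂ x ^ 2) * ∫⁻ x, F₃ x ^ 2 := by
  grw [sq_trilinearForm_le_lconvolution h₁ h₂ h₃,
    lintegral_sq_lconvolution_le_of_kpRegionTop h₁ h₂ s₁ s₂]
  gcongr
  rw [le_div_iff₀ (by positivity)]
  calc 256 * Real.pi * 2 ^ j₁ * 2 ^ j₂ * (2 ^ j₃ + K)
      ≤ 256 * 3.15 * 2 ^ j₁ * 2 ^ j₂ * (1025 * 2 ^ j₃) := by
        gcongr
        · exact Real.pi_lt_d2.le
        · linarith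
    _ = 256 * 3.15 * 1025 * (2 ^ j₁ * 2 ^ j₂ * 2 ^ j₃) := by ring
    _ ≤ _ := by gcongr; norm_num

theorem sq_trilinearForm_le_of_resonant (h₁ : Measurable F₁) (h₂ : Measurable F₂)
    (h₃ : Measurable F₃) (s₁ : F₁.support ⊆ kpRegionTop k₁ j₁)
    (s₂ : F₂.support ⊆ kpRegionTop k₂ j₂) (s₃ : F₃.support ⊆ kpRegionTop k₃ j₃) (hj₁ : j₁ ≤ j₃)
    (hj₂ : j₂ ≤ j₃) (hres : (2 : ℝ) ^ 10 * 2 ^ j₃ ≤ 2 ^ (k₁ + k₂ + k₃)) :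
    trilinearForm F₁ F₂ F₃ ^ 2 ≤
      ENNReal.ofReal (1536 * (2 ^ j₁ * 2 ^ j₂ * 2 ^ j₃) / 2 ^ (k₁ + k₂ + k₃)) *
        (∫⁻ x, F₁ x ^ 2) * (∫⁻ x, F₂ x ^ 2) * ∫⁻ x, F₃ x ^ 2 := by
  rcases le_total k₂ k₁ with hk | hk
  · exact sq_trilinearForm_le_of_resonant_of_le h₁ h₂ h₃ s₁ s₂ s₃ hj₁ hj₂ hk hres
  · rw [trilinearForm_swap_left h₁ h₂ h₃]
    refine (sq_trilinearForm_le_of_resonant_of_le h₂ h₁ h₃ s₂ s₁ s₃ hj₂ hj₁ hk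
      (by rwa [add_comm k₂])).trans_eq ?_
    rw [add_comm k₂, mul_comm ((2 : ℝ) ^ j₂), mul_right_comm (ENNReal.ofReal _)]

theorem sq_trilinearForm_le_of_max_third (h₁ : Measurable F₁) (h₂ : Measurable F₂)
    (h₃ : Measurable F₃) (s₁ : F₁.support ⊆ kpRegionTop k₁ j₁)
    (s₂ : F₂.support ⊆ kpRegionTop k₂ j₂) (s₃ : F₃.support ⊆ kpRegionTop k₃ j₃) (hj₁ : j₁ ≤ j₃)
    (hj₂ : j₂ ≤ j₃) :
    trilinearForm F₁ F₂ F₃ ^ 2 ≤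
      ENNReal.ofReal (10 ^ 6 * (2 ^ j₁ * 2 ^ j₂ * 2 ^ j₃) / (2 ^ j₃ + 2 ^ (k₁ + k₂ + k₃))) *
        (∫⁻ x, F₁ x ^ 2) * (∫⁻ x, F₂ x ^ 2) * ∫⁻ x, F₃ x ^ 2 := by
  rcases le_total ((2 : ℝ) ^ (k₁ + k₂ + k₃)) (2 ^ 10 * 2 ^ j₃) with hres | hres
  · exact sq_trilinearForm_le_of_nonresonant h₁ h₂ h₃ s₁ s₂ (by positivity) hres
  grw [sq_trilinearForm_le_of_resonant h₁ h₂ h₃ s₁ s₂ s₃ hj₁ hj₂ hres]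
  gcongr ENNReal.ofReal ?_ * _ * _ * _
  rw [div_le_div_iff₀ (by positivity) (by positivity)]
  calc 1536 * (2 ^ j₁ * 2 ^ j₂ * 2 ^ j₃) * (2 ^ j₃ + 2 ^ (k₁ + k₂ + k₃))
      ≤ 1536 * (2 ^ j₁ * 2 ^ j₂ * 2 ^ j₃) *
          ((2 : ℝ) ^ (k₁ + k₂ + k₃) + 2 ^ (k₁ + k₂ + k₃)) := by
        gcongr
        linarith [(by positivity : (0 : ℝ) < 2 ^ j₃)]
    _ = 3072 * (2 ^ j₁ * 2 ^ j₂ * 2 ^ j₃) * (2 : ℝ) ^ (k₁ + k₂ + k₃) := by ring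
    _ ≤ _ := by gcongr; norm_num

theorem sq_trilinearForm_le_of_kpRegionTop (h₁ : Measurable F₁) (h₂ : Measurable F₂)
    (h₃ : Measurable F₃) (s₁ : F₁.support ⊆ kpRegionTop k₁ j₁)
    (s₂ : F₂.support ⊆ kpRegionTop k₂ j₂) (s₃ : F₃.support ⊆ kpRegionTop k₃ j₃) :
    trilinearForm F₁ F₂ F₃ ^ 2 ≤
      ENNReal.ofReal (10 ^ 6 * (2 ^ j₁ * 2 ^ j₂ * 2 ^ j₃) /
        (2 ^ max j₁ (max j₂ j₃) + 2 ^ (k₁ + k₂ + k₃))) *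
        (∫⁻ x, F₁ x ^ 2) * (∫⁻ x, F₂ x ^ 2) * ∫⁻ x, F₃ x ^ 2 := by
  obtain ⟨h13, h23⟩ | ⟨h12, h32⟩ | ⟨h21, h31⟩ :
      (j₁ ≤ j₃ ∧ j₂ ≤ j₃) ∨ (j₁ ≤ j₂ ∧ j₃ ≤ j₂) ∨ (j₂ ≤ j₁ ∧ j₃ ≤ j₁) := by omega
  · rw [max_eq_right h23, max_eq_right h13]
    exact sq_trilinearForm_le_of_max_third h₁ h₂ h₃ s₁ s₂ s₃ h13 h23
  · rw [max_eq_left h32, max_eq_right h12, trilinearForm_swap_right]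
    refine (sq_trilinearForm_le_of_max_third h₁ h₃ h₂ s₁ s₃ s₂ h12 h32).trans_eq ?_
    rw [add_right_comm, mul_right_comm ((2 : ℝ) ^ j₁), mul_right_comm (ENNReal.ofReal _ * _)]
  · rw [max_eq_left (max_le h21 h31), trilinearForm_swap_left h₁ h₂ h₃, trilinearForm_swap_right]
    refine (sq_trilinearForm_le_of_max_third h₂ h₃ h₁ s₂ s₃ s₁ h21 h31).trans_eq ?_
    rw [add_comm (k₂ + k₃), ← add_assoc, mul_comm ((2 : ℝ) ^ j₂ * _), ← mul_assoc ((2 : ℝ) ^ j₁)]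
    ring

end Unweighted

section Transference

theorem sq_eLpNorm_two {α E : Type*} [MeasurableSpace α] {μ : Measure α} [NormedAddCommGroup E]
    (f : α → E) : eLpNorm f 2 μ ^ 2 = ∫⁻ x, ‖f x‖ₑ ^ 2 ∂μ := by
  simpa using eLpNorm_nnreal_pow_eq_lintegral (μ := μ) (f := f) (p := 2) two_ne_zero

theorem exists_measurable_ae_eq_enorm {α E : Type*} [MeasurableSpace α] {μ : Measure α}
    [NormedAddCommGroup E] {f : α → E} (hf : AEStronglyMeasurable f μ) {D : Set α}
    (hD : MeasurableSet D) (hfD : ∀ᵐ x ∂μ, x ∉ D → f x = 0) :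
    ∃ F : α → ℝ≥0∞, Measurable F ∧ F.support ⊆ D ∧ F =ᵐ[μ] fun x => ‖f x‖ₑ := by
  refine ⟨D.indicator fun x => ‖hf.mk f x‖ₑ, hf.stronglyMeasurable_mk.enorm.indicator hD,
    Set.support_indicator_subset, ?_⟩
  filter_upwards [hfD, hf.ae_eq_mk] with x hx hmk
  by_cases hxD : x ∈ D
  · rw [Set.indicator_of_mem hxD, hmk]
  · rw [Set.indicator_of_notMem hxD, hx hxD, enorm_zero]

variable {G A : Type*} [AddCommGroup G] [NormedRing A] [NormedAlgebra ℝ A] {f₁ f₂ : G → A}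
  {F₁ F₂ : G → ℝ≥0∞}

theorem enorm_convolution_mul_le_lconvolution [MeasurableSpace G] [MeasurableAdd₂ G]
    [MeasurableNeg G] {μ : Measure G} [SFinite μ] [μ.IsAddLeftInvariant]
    (e₁ : F₁ =ᵐ[μ] fun x => ‖f₁ x‖ₑ) (e₂ : F₂ =ᵐ[μ] fun x => ‖f₂ x‖ₑ) (x : G) :
    ‖(f₁ ⋆[ContinuousLinearMap.mul ℝ A, μ] f₂) x‖ₑ ≤ (F₁ ⋆ₗ[μ] F₂) x := by
  refine (enorm_integral_le_lintegral_enorm _).trans (lintegral_mono_ae ?_)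
  filter_upwards [e₁, (quasiMeasurePreserving_sub_left μ x).ae e₂] with t ht₁ ht₂
  rw [ht₁, neg_add_eq_sub, ht₂]
  simpa only [ContinuousLinearMap.mul_apply', enorm_eq_nnnorm, ← ENNReal.coe_mul,
    ENNReal.coe_le_coe] using nnnorm_mul_le (f₁ t) (f₂ (x - t))

theorem eLpNorm_indicator_convolution_le_of_trilinearForm [MeasureSpace G] [MeasurableAdd₂ G]
    [MeasurableNeg G] [SFinite (volume : Measure G)] [(volume : Measure G).IsAddLeftInvariant]
    [(volume : Measure G).IsNegInvariant]
    (h₁ : Measurable F₁) (h₂ : Measurable F₂) (e₁ : F₁ =ᵐ[volume] fun x => ‖f₁ x‖ₑ)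
    (e₂ : F₂ =ᵐ[volume] fun x => ‖f₂ x‖ₑ) {D : Set G} (hD : MeasurableSet D) (hDneg : -D = D)
    (hfin : ∫⁻ x, (F₁ ⋆ₗ F₂) x ^ 2 ≠ ∞) {K : ℝ≥0∞}
    (hK : ∀ F₃ : G → ℝ≥0∞, Measurable F₃ → F₃.support ⊆ D →
      trilinearForm F₁ F₂ F₃ ^ 2 ≤ K ^ 2 * ∫⁻ x, F₃ x ^ 2) :
    eLpNorm (D.indicator (f₁ ⋆[ContinuousLinearMap.mul ℝ A, volume] f₂)) 2 volume ≤ K := by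
  rw [← ENNReal.pow_le_pow_left_iff two_ne_zero, sq_eLpNorm_two]
  refine le_trans (lintegral_mono fun x => ?_)
    (lintegral_sq_indicator_lconvolution_le_of_dual h₁ h₂ hD hDneg hfin hK)
  rw [enorm_indicator_eq_indicator_enorm]
  gcongr ?_ ^ 2
  exact Set.indicator_le_indicator (enorm_convolution_mul_le_lconvolution e₁ e₂ x)

end Transference

section RestrictedConvolution

variable {k₁ k₂ k : ℤ} {j₁ j₂ j : ℕ} {f₁ f₂ : ℝ × ℝ × ℝ → ℝ}

theorem restrictedConvNorm_le_of_trilinearForm (hf₁ : MemLp f₁ 2) (hf₂ : MemLp f₂ 2)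
    (hs₁ : ∀ᵐ x, x ∉ kpRegionTop k₁ j₁ → f₁ x = 0) (hs₂ : ∀ᵐ x, x ∉ kpRegionTop k₂ j₂ → f₂ x = 0)
    {c : ℝ≥0∞} {w : ℝ × ℝ × ℝ → ℝ}
    (hc : ∀ F₁ F₂ F₃ : ℝ × ℝ × ℝ → ℝ≥0∞, Measurable F₁ → Measurable F₂ → Measurable F₃ →
      F₁.support ⊆ kpRegionTop k₁ j₁ → F₂.support ⊆ kpRegionTop k₂ j₂ →
      F₃.support ⊆ kpRegionTop k j →
      trilinearForm F₁ F₂ F₃ ^ 2 ≤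
        c ^ 2 * (∫⁻ x, (‖w x‖ₑ * F₁ x) ^ 2) * (∫⁻ x, F₂ x ^ 2) * ∫⁻ x, F₃ x ^ 2) :
    restrictedConvNorm (kpRegionTop k j) f₁ f₂ ≤
      c * eLpNorm (fun x => w x * f₁ x) 2 volume * eLpNorm f₂ 2 volume := by
  obtain ⟨F₁, h₁, s₁, e₁⟩ :=
    exists_measurable_ae_eq_enorm hf₁.1 (measurableSet_kpRegionTop k₁ j₁) hs₁
  obtain ⟨F₂, h₂, s₂, e₂⟩ :=
    exists_measurable_ae_eq_enorm hf₂.1 (measurableSet_kpRegionTop k₂ j₂) hs₂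
  have hnorm {F : ℝ × ℝ × ℝ → ℝ≥0∞} {f : ℝ × ℝ × ℝ → ℝ} (e : F =ᵐ[volume] fun x => ‖f x‖ₑ) :
      ∫⁻ x, F x ^ 2 = eLpNorm f 2 volume ^ 2 := by
    rw [sq_eLpNorm_two]
    exact lintegral_congr_ae (e.mono fun x hx => by simp only [hx])
  have hwnorm : ∫⁻ x, (‖w x‖ₑ * F₁ x) ^ 2 = eLpNorm (fun x => w x * f₁ x) 2 volume ^ 2 :=
    hnorm (e₁.mono fun x hx => by simp only [hx, enorm_mul])
  have hfin : ∫⁻ x, (F₁ ⋆ₗ F₂) x ^ 2 ≠ ∞ := by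
    refine ne_top_of_le_ne_top ?_ (lintegral_sq_lconvolution_le_of_kpRegionTop h₁ h₂ s₁ s₂)
    rw [hnorm e₁, hnorm e₂]
    exact ENNReal.mul_ne_top (ENNReal.mul_ne_top ENNReal.ofReal_ne_top
      (ENNReal.pow_ne_top hf₁.2.ne)) (ENNReal.pow_ne_top hf₂.2.ne)
  refine eLpNorm_indicator_convolution_le_of_trilinearForm h₁ h₂ e₁ e₂
    (measurableSet_kpRegionTop k j) (neg_kpRegionTop k j) hfin fun F₃ h₃ s₃ => ?_
  refine (hc F₁ F₂ F₃ h₁ h₂ h₃ s₁ s₂ s₃).trans_eq ?_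
  rw [hwnorm, hnorm e₂, mul_pow, mul_pow]

theorem sq_two_rpow_half (s : ℝ) : ((2 : ℝ) ^ (s / 2)) ^ 2 = 2 ^ s := by
  rw [← Real.rpow_mul_natCast zero_le_two, Nat.cast_ofNat, div_mul_cancel₀ s two_ne_zero]

theorem restrictedConvNorm_le_of_modulation (hf₁ : MemLp f₁ 2) (hf₂ : MemLp f₂ 2)
    (hs₁ : ∀ᵐ x, x ∉ kpRegionTop k₁ j₁ → f₁ x = 0)
    (hs₂ : ∀ᵐ x, x ∉ kpRegionTop k₂ j₂ → f₂ x = 0) {C : ℝ} (hC : 1000 ≤ C) :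
    restrictedConvNorm (kpRegionTop k j) f₁ f₂ ≤
      ENNReal.ofReal (C * (2 : ℝ) ^ (((j₁ : ℝ) + j₂ + j) / 2) *
        ((2 : ℝ) ^ max j₁ (max j₂ j) + (2 : ℝ) ^ (k₁ + k₂ + k)) ^ (-(1 / 2) : ℝ)) *
      eLpNorm f₁ 2 volume * eLpNorm f₂ 2 volume := by
  have hweight : eLpNorm f₁ 2 volume = eLpNorm (fun x => 1 * f₁ x) 2 volume := by
    simp only [one_mul]
  rw [hweight]
  refine restrictedConvNorm_le_of_trilinearForm (w := 1) hf₁ hf₂ hs₁ hs₂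
    fun F₁ F₂ F₃ h₁ h₂ h₃ s₁ s₂ s₃ => ?_
  simp only [Pi.one_apply, enorm_one, one_mul]
  grw [sq_trilinearForm_le_of_kpRegionTop h₁ h₂ h₃ s₁ s₂ s₃]
  gcongr
  rw [← ENNReal.ofReal_pow (by positivity)]
  gcongr
  set S : ℝ := (2 : ℝ) ^ max j₁ (max j₂ j) + (2 : ℝ) ^ (k₁ + k₂ + k)
  have hS : (S ^ (-(1 / 2) : ℝ)) ^ 2 = S⁻¹ := by
    rw [← Real.rpow_mul_natCast (by positivity), ← Real.rpow_neg_one]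
    norm_num
  rw [mul_pow, mul_pow, sq_two_rpow_half, hS, Real.rpow_add two_pos, Real.rpow_add two_pos,
    Real.rpow_natCast, Real.rpow_natCast, Real.rpow_natCast, div_eq_mul_inv]
  gcongr
  nlinarith

theorem restrictedConvNorm_le_of_weight (hf₁ : MemLp f₁ 2) (hf₂ : MemLp f₂ 2)
    (hs₁ : ∀ᵐ x, x ∉ kpRegionTop k₁ j₁ → f₁ x = 0) (hs₂ : ∀ᵐ x, x ∉ kpRegionTop k₂ j₂ → f₂ x = 0)
    {C s : ℝ} (hC : 0 ≤ C) (hCs : 32 * (2 * 2 ^ k₁ + (2 * 2 ^ k₁) ^ 2) ≤ C ^ 2 * 2 ^ s) :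
    restrictedConvNorm (kpRegionTop k j) f₁ f₂ ≤
      ENNReal.ofReal (C * (2 : ℝ) ^
        ((s + (min k₁ (min k₂ k) : ℤ) + (min j₁ (min j₂ j) : ℕ)) / 2)) *
      eLpNorm (fun x => kpWeight x.1 x.2.1 * f₁ x) 2 volume * eLpNorm f₂ 2 volume := by
  refine restrictedConvNorm_le_of_trilinearForm hf₁ hf₂ hs₁ hs₂
    fun F₁ F₂ F₃ h₁ h₂ h₃ s₁ s₂ s₃ => ?_
  simp only [Real.enorm_of_nonneg (kpWeight_pos _ _).le]
  grw [sq_trilinearForm_le_weighted h₁ h₂ h₃ s₁ s₂ s₃]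
  rw [← ENNReal.ofReal_pow (by positivity)]
  gcongr ENNReal.ofReal ?_ * _ * _ * _
  have hminj : (2 : ℝ) ^ min j₁ (min j₂ j) = min (2 ^ j₁) (min (2 ^ j₂) (2 ^ j)) := by
    rw [(pow_right_mono₀ one_le_two).map_min, (pow_right_mono₀ one_le_two).map_min]
  have hmink : (2 : ℝ) ^ min k₁ (min k₂ k) = min (2 ^ k₁) (min (2 ^ k₂) (2 ^ k)) := by
    rw [(zpow_right_mono₀ one_le_two).map_min, (zpow_right_mono₀ one_le_two).map_min]
  rw [mul_pow C, sq_two_rpow_half, Real.rpow_add two_pos, Real.rpow_add two_pos,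
    Real.rpow_intCast, Real.rpow_natCast, ← hminj, ← hmink, ← mul_assoc, ← mul_assoc]
  gcongr ?_ * _ * _
  refine le_trans ?_ hCs
  gcongr
  linarith [Real.pi_lt_four]

end RestrictedConvolution

theorem mainTheorem8_general (N : ℕ) : ∃ C : ℝ, 0 < C ∧
    ∀ (k₁ k₂ k : ℤ) (j₁ j₂ j : ℕ) (f₁ f₂ : ℝ × ℝ × ℝ → ℝ), MemLp f₁ 2 → MemLp f₂ 2 →
      (∀ᵐ x, x ∉ kpRegionTop k₁ j₁ → f₁ x = 0) → (∀ᵐ x, x ∉ kpRegionTop k₂ j₂ → f₂ x = 0) →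
      restrictedConvNorm (kpRegionTop k j) f₁ f₂ ≤
        ENNReal.ofReal (C * (2 : ℝ) ^ (((j₁ : ℝ) + j₂ + j) / 2) *
          ((2 : ℝ) ^ max j₁ (max j₂ j) + (2 : ℝ) ^ (k₁ + k₂ + k)) ^ (-(1 / 2) : ℝ)) *
        eLpNorm f₁ 2 volume * eLpNorm f₂ 2 volume ∧
      (k₁ ≤ N → restrictedConvNorm (kpRegionTop k j) f₁ f₂ ≤
        ENNReal.ofReal (C * (2 : ℝ) ^
          (((k₁ : ℝ) + (min k₁ (min k₂ k) : ℤ) + (min j₁ (min j₂ j) : ℕ)) / 2)) *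
        eLpNorm (fun x => kpWeight x.1 x.2.1 * f₁ x) 2 volume * eLpNorm f₂ 2 volume) ∧
      (-N ≤ k₁ → restrictedConvNorm (kpRegionTop k j) f₁ f₂ ≤
        ENNReal.ofReal (C * (2 : ℝ) ^
          ((2 * (k₁ : ℝ) + (min k₁ (min k₂ k) : ℤ) + (min j₁ (min j₂ j) : ℕ)) / 2)) *
        eLpNorm (fun x => kpWeight x.1 x.2.1 * f₁ x) 2 volume * eLpNorm f₂ 2 volume) := by
  have hB : (1 : ℝ) ≤ 2 ^ N := one_le_pow₀ one_le_two
  refine ⟨1000 * 2 ^ N, by positivity, fun k₁ k₂ k j₁ j₂ j f₁ f₂ hf₁ hf₂ hs₁ hs₂ =>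
    ⟨restrictedConvNorm_le_of_modulation hf₁ hf₂ hs₁ hs₂ (by linarith), fun hk => ?_, fun hk => ?_⟩⟩
  all_goals
    refine restrictedConvNorm_le_of_weight hf₁ hf₂ hs₁ hs₂ (by positivity) ?_
    have hpos : (0 : ℝ) < 2 ^ k₁ := by positivity
  · have hupper : (2 : ℝ) ^ k₁ ≤ 2 ^ N := by
      simpa using zpow_le_zpow_right₀ (one_le_two (α := ℝ)) hk
    rw [Real.rpow_intCast]
    nlinarith [mul_le_mul_of_nonneg_right hupper hpos.le, mul_le_mul_of_nonneg_right hB hpos.le,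
      mul_le_mul_of_nonneg_right hB (mul_pos (by positivity : (0 : ℝ) < 2 ^ N) hpos).le]
  · have hlower : 1 ≤ (2 : ℝ) ^ N * 2 ^ k₁ := by
      rw [← zpow_natCast, ← zpow_add₀ two_ne_zero]
      exact one_le_zpow₀ one_le_two (by linarith)
    rw [two_mul (k₁ : ℝ), Real.rpow_add two_pos, Real.rpow_intCast]
    have hx : (2 : ℝ) ^ k₁ ≤ 2 ^ N * (2 ^ k₁ * 2 ^ k₁) := by nlinarith
    have hx2 : 2 ^ N * ((2 : ℝ) ^ k₁ * 2 ^ k₁) ≤ (2 ^ N * 2 ^ N) * (2 ^ k₁ * 2 ^ k₁) := by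
      gcongr
      exact le_mul_of_one_le_left (by positivity) hB
    nlinarith [mul_le_mul_of_nonneg_right hB (mul_pos hpos hpos).le]

theorem mainTheorem8 :
    (∃ C : ℝ, 0 < C ∧ ∀ (k₁ k₂ k : ℤ) (j₁ j₂ j : ℕ) (f₁ f₂ : ℝ × ℝ × ℝ → ℝ),
      IsNonnegL2SupportedIn f₁ (kpRegionTop k₁ j₁) →
      IsNonnegL2SupportedIn f₂ (kpRegionTop k₂ j₂) →
      restrictedConvNorm (kpRegionTop k j) f₁ f₂ ≤
        ENNReal.ofReal (C * (2 : ℝ) ^ (((j₁ : ℝ) + j₂ + j) / 2) *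
          ((2 : ℝ) ^ max j₁ (max j₂ j) + (2 : ℝ) ^ (k₁ + k₂ + k)) ^ (-(1 / 2) : ℝ)) *
        eLpNorm f₁ 2 volume * eLpNorm f₂ 2 volume) ∧
    (∃ C : ℝ, 0 < C ∧ ∀ (k₁ k₂ k : ℤ) (j₁ j₂ j : ℕ) (f₁ f₂ : ℝ × ℝ × ℝ → ℝ),
      IsNonnegL2SupportedIn f₁ (kpRegionTop k₁ j₁) →
      IsNonnegL2SupportedIn f₂ (kpRegionTop k₂ j₂) →
      k₁ ≤ 100 →
      restrictedConvNorm (kpRegionTop k j) f₁ f₂ ≤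
        ENNReal.ofReal (C * (2 : ℝ) ^
          (((k₁ : ℝ) + (min k₁ (min k₂ k) : ℤ) + (min j₁ (min j₂ j) : ℕ)) / 2)) *
        eLpNorm (fun x => kpWeight x.1 x.2.1 * f₁ x) 2 volume * eLpNorm f₂ 2 volume) ∧
    (∃ C : ℝ, 0 < C ∧ ∀ (k₁ k₂ k : ℤ) (j₁ j₂ j : ℕ) (f₁ f₂ : ℝ × ℝ × ℝ → ℝ),
      IsNonnegL2SupportedIn f₁ (kpRegionTop k₁ j₁) →
      IsNonnegL2SupportedIn f₂ (kpRegionTop k₂ j₂) →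
      -100 ≤ k₁ →
      restrictedConvNorm (kpRegionTop k j) f₁ f₂ ≤
        ENNReal.ofReal (C * (2 : ℝ) ^
          ((2 * (k₁ : ℝ) + (min k₁ (min k₂ k) : ℤ) + (min j₁ (min j₂ j) : ℕ)) / 2)) *
        eLpNorm (fun x => kpWeight x.1 x.2.1 * f₁ x) 2 volume * eLpNorm f₂ 2 volume) := by
  obtain ⟨C, hC, h⟩ := mainTheorem8_general 100
  exact ⟨⟨C, hC, fun _ _ _ _ _ _ _ _ hf₁ hf₂ => (h _ _ _ _ _ _ _ _ hf₁.1 hf₂.1 hf₁.2.2 hf₂.2.2).1⟩,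
    ⟨C, hC, fun _ _ _ _ _ _ _ _ hf₁ hf₂ => (h _ _ _ _ _ _ _ _ hf₁.1 hf₂.1 hf₁.2.2 hf₂.2.2).2.1⟩,
    ⟨C, hC, fun _ _ _ _ _ _ _ _ hf₁ hf₂ => (h _ _ _ _ _ _ _ _ hf₁.1 hf₂.1 hf₁.2.2 hf₂.2.2).2.2⟩⟩
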